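/- **Cut-matching game for directed edge expansion.** Let $V=\{1,\dots,n\}$ with $n\ge 2$ and let $\pi:V\to\mathbb R_{>0}$ be vertex weights; write $\pi(S)=\sum_{i\in S}\pi(i)$. A weighted directed graph on $V$ is a nonnegative matrix $D=(D(i,j))$, and it is *Eulerian* if $\sum_j D(i,j)=\sum_j D(j,i)$ for all $i$. With $D(\delta^+(S)):=\sum_{i\in S,\,j\notin S}D(i,j)$ its $\pi$-weighted edge expansion is $$\vec\phi_\pi(D):=\min_{\emptyset\ne S\subsetneq V}\frac{\min\{D(\delta^+(S)),\,D(\delta^+(\overline S))\}}{\min\{\pi(S),\pi(\overline S)\}}.$$ *The game.* In each round the cut player, who knows what has been played so far and may randomize, chooses a bipartition $(L,R)$ of $V$. The matching player, who knows the past and the current bipartition and may also randomize, answers with a directed fractional perfect matching between $L$ and $R$: a nonnegative matrix $D$ with $D(i,j)=0$ unless exactly one of $i,j$ is in $L$, in which each $i\in L$ has indegree and outdegree exactly $\pi(R)\pi(i)/\pi(L)$ and each $j\in R$ has indegree and outdegree exactly $\pi(j)$. The union of the matchings $D_1,\dots,D_T$ is the weighted graph $D_1+\dots+D_T$. *The cut-player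 strategy.* Let $L_{\rm sym}(D)=\sum_{i<j}\frac12\big(D(i,j)+D(j,i)\big)L_{ij}$, where $L_{ij}$ is the Laplacian of the undirected edge $ij$, let $\Pi=\mathrm{diag}(\pi)$, and let $P=I-\frac1{\pi(V)}\Pi^{1/2}\mathbf 1\mathbf 1^{\top}\Pi^{1/2}$. Given the matchings $D_1,\dots,D_{t-1}$ played so far, put $M_s=\Pi^{-1/2}L_{\rm sym}(D_s)\Pi^{-1/2}$, $E=\exp\big(-\frac{\eta}{\rho}\sum_{s<t}M_s\big)$ with $\eta=\frac14$ and $\rho=4$, $X=PEP/\mathrm{tr}(PEP)$ and $Y=\Pi^{-1/2}X\Pi^{-1/2}$, and let $v_1,\dots,v_n\in\mathbb R^n$ be a Gram decomposition of $Y$. If some vertex $i$ has $\pi(i)\ge\frac14\pi(V)$, play $L=\{i\}$ for such a vertex. Otherwise draw a fresh $u\sim\mathcal N(0,I)$, let $y$ be the $\pi$-weighted (lower) median of the numbers $\langle u,v_i\rangle$, that is, the smallest of these numbers such that $\pi(\{i:\langle u,v_i\rangle\le y\})\ge\frac12\pi(V)$, and play $L=\{i:\langle u,v_i\rangle\le y\}$,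 $R=V\setminus L$. **Theorem.** For every $p<1$ there are constants $C,c>0$, depending only on $p$, such that the following holds with $T=\lceil C\log^2 n\rceil$. 1. For all $n\ge2$ and all $\pi:V\to\mathbb R_{>0}$, if the cut player follows the strategy above, then against every strategy of the matching player, with probability at least $p$, the union of the matchings played in $T$ rounds is an Eulerian graph with $\vec\phi_\pi\ge c\log n$. 2. (Unweighted game with bisections.) For every even $n\ge2$ there is a cut-player strategy that plays only bisections ($|L|=|R|=n/2$, with probability one) such that, in the game with $\pi\equiv1$ (where in each matching every vertex has indegree and outdegree exactly one), against every strategy of the matching player, with probability at least $p$, the union of the matchings played in $T$ rounds is an Eulerian graph with $\vec\phi_{\mathbf 1}\ge c\log n$. For $n\ne4$ this strategy is the one above with $\pi\equiv 1$. -/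

import Mathlib

open MeasureTheory ProbabilityTheory
open scoped ENNReal

noncomputable section

namespace CutMatching

variable {V : Type*} [Fintype V] [DecidableEq V]

/-! ## Weighted directed graphs and directed edge expansion

A weighted directed graph on `V` is given by its matrix `A` of edge weights, where `A i j` is the
weight of the edge from `i` to `j` and weight zero means that there is no edge. -/

/-- The weight `π(S)` of a vertex set. -/
def weight (π : V → ℝ) (S : Finset V) : ℝ := ∑ i ∈ S, π i

/-- The total weight of the edges going out of `S`. -/
def outWeight (A : Matrix V V ℝ) (S : Finset V) : ℝ := ∑ i ∈ S, ∑ j ∈ Sᶜ, A i j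

/-- The `π`-weighted directed edge expansion of a vertex set. -/
def setExpansion (π : V → ℝ) (A : Matrix V V ℝ) (S : Finset V) : ℝ :=
  min (outWeight A S) (outWeight A Sᶜ) / min (weight π S) (weight π Sᶜ)

/-- The `π`-weighted directed edge expansion of a graph: the minimum of the expansion over the
(finitely many) nonempty proper vertex sets. -/
def edgeExpansion (π : V → ℝ) (A : Matrix V V ℝ) : ℝ :=
  ⨅ S : {S : Finset V // S.Nonempty ∧ Sᶜ.Nonempty}, setExpansion π A S

/-- A weighted directed graph is Eulerian if at every vertex the indegree is the outdegree. -/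
structure IsEulerian (A : Matrix V V ℝ) : Prop where
  nonneg : ∀ i j, 0 ≤ A i j
  balanced : ∀ i, ∑ j, A i j = ∑ j, A j i

/-! ## The directed cut-matching game -/

/-- A directed fractional perfect matching between `L` and `R = Lᶜ`. For `π = 1` and a bisection,
every vertex has indegree and outdegree one. -/
structure IsDirectedMatching (π : V → ℝ) (L : Finset V) (D : Matrix V V ℝ) : Prop where
  nonneg : ∀ i j, 0 ≤ D i j
  crossing : ∀ i j, D i j ≠ 0 → (i ∈ L ↔ j ∉ L)
  out_left : ∀ i ∈ L, ∑ j, D i j = weight π Lᶜ * π i / weight π L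
  in_left : ∀ i ∈ L, ∑ j, D j i = weight π Lᶜ * π i / weight π L
  out_right : ∀ j ∈ Lᶜ, ∑ i, D j i = π j
  in_right : ∀ j ∈ Lᶜ, ∑ i, D i j = π j

/-- What has been played so far: the cuts `(L, Lᶜ)`, recorded by `L`, with the answers. -/
abbrev History (V : Type*) := List (Finset V × Matrix V V ℝ)

/-- The matchings played so far. -/
def matchings (h : History V) : List (Matrix V V ℝ) := h.map Prod.snd

/-- The union of the matchings played so far, as a weighted directed graph. -/
def union (h : History V) : Matrix V V ℝ := (matchings h).sum

/-- A (randomized, adaptive) strategy of the cut player. -/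
abbrev CutStrategy (V : Type*) := History V → PMF (Finset V)

/-- A (randomized, adaptive) strategy of the matching player, who sees the history and the
current cut. -/
abbrev MatchingStrategy (V : Type*) := History V → Finset V → PMF (Matrix V V ℝ)

/-- The matching player answers every cut into two nonempty parts with a directed fractional
perfect matching. -/
def MatchingStrategy.IsLegal (π : V → ℝ) (τ : MatchingStrategy V) : Prop :=
  ∀ (h : History V) (L : Finset V), L.Nonempty → Lᶜ.Nonempty →
    ∀ D ∈ (τ h L).support, IsDirectedMatching π L D

/-- The distribution of the history after `t` rounds. -/
def play (σ : CutStrategy V) (τ : MatchingStrategy V) : ℕ → PMF (History V)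
  | 0 => PMF.pure []
  | t + 1 => (play σ τ t).bind fun h =>
      (σ h).bind fun L => (τ h L).map fun D => h ++ [(L, D)]

/-! ## The cut-player strategy

Matrix multiplicative weight update on the symmetric Laplacians of the matchings, followed by a
cut at the weighted median of a random Gaussian projection. -/

/-- The symmetric Laplacian, the sum over unordered pairs `{i, j}` of
`(A i j + A j i) / 2` times the Laplacian of the undirected edge `ij`. -/
def symLaplacian (A : Matrix V V ℝ) : Matrix V V ℝ :=
  Matrix.diagonal (fun i => ∑ j, (A i j + A j i) / 2) - (1 / 2 : ℝ) • (A + A.transpose)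

/-- The diagonal matrix `Π^{-1/2}`. -/
def invSqrtWeight (π : V → ℝ) : Matrix V V ℝ := Matrix.diagonal fun i => (√(π i))⁻¹

/-- The feedback matrix `Π^{-1/2} L_sym(D) Π^{-1/2}`. -/
def feedback (π : V → ℝ) (D : Matrix V V ℝ) : Matrix V V ℝ :=
  invSqrtWeight π * symLaplacian D * invSqrtWeight π

/-- The orthogonal projection onto the complement of the vector `Π^{1/2} 1`. -/
def proj (π : V → ℝ) : Matrix V V ℝ :=
  1 - (weight π Finset.univ)⁻¹ • Matrix.vecMulVec (fun i => √(π i)) (fun i => √(π i))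

/-- The step size of the multiplicative weight update. -/
def stepSize : ℝ := 1 / 4

/-- The width bound of the multiplicative weight update. -/
def width : ℝ := 4

/-- The matrix exponential of `-η/ρ` times the sum of the feedback matrices so far. -/
def expFeedback (π : V → ℝ) (h : History V) : Matrix V V ℝ :=
  NormedSpace.exp (-(stepSize / width) • ((matchings h).map (feedback π)).sum)

/-- The density matrix `X`: the matrix exponential, projected onto the complement of `Π^{1/2} 1`
and scaled to have trace one. -/
def density (π : V → ℝ) (h : History V) : Matrix V V ℝ :=
  (proj π * expFeedback π h * proj π).trace⁻¹ • (proj π * expFeedback π h * proj π)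

/-- The matrix `Y = Π^{-1/2} X Π^{-1/2}`. -/
def embeddingGram (π : V → ℝ) (h : History V) : Matrix V V ℝ :=
  invSqrtWeight π * density π h * invSqrtWeight π

lemma symLaplacian_isSymm (A : Matrix V V ℝ) : (symLaplacian A).IsSymm := by
  unfold symLaplacian Matrix.IsSymm
  simp [Matrix.transpose_sub, Matrix.transpose_add, add_comm]

set_option linter.unusedSectionVars false in
lemma invSqrtWeight_isSymm (π : V → ℝ) : (invSqrtWeight π).IsSymm := by
  simp [invSqrtWeight, Matrix.IsSymm]

lemma feedback_isSymm (π : V → ℝ) (A : Matrix V V ℝ) : (feedback π A).IsSymm := by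
  unfold feedback Matrix.IsSymm
  rw [Matrix.transpose_mul, Matrix.transpose_mul, (symLaplacian_isSymm A).eq,
    (invSqrtWeight_isSymm π).eq, Matrix.mul_assoc]

lemma proj_isSymm (π : V → ℝ) : (proj π).IsSymm := by
  unfold proj Matrix.IsSymm
  simp [Matrix.transpose_sub, Matrix.transpose_vecMulVec]

lemma sum_feedback_isSymm (π : V → ℝ) (l : List (Matrix V V ℝ)) :
    ((l.map (feedback π)).sum).IsSymm := by
  induction l with
  | nil => simp [Matrix.IsSymm]
  | cons a l ih => simpa using (feedback_isSymm π a).add ih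

/-- The matrix `Y` has a Gram decomposition. -/
theorem exists_gram (π : V → ℝ) (h : History V) :
    ∃ B : Matrix V V ℝ, B.transpose * B = embeddingGram π h := by
  set S := ((matchings h).map (feedback π)).sum with hS
  set E : Matrix V V ℝ := NormedSpace.exp (-(stepSize / width / 2) • S) with hE
  have hsymm : E.IsSymm := ((sum_feedback_isSymm π (matchings h)).smul _).exp
  have hEE : E * E = expFeedback π h := by
    rw [hE, ← Matrix.exp_add_of_commute _ _ (Commute.refl _), ← add_smul, expFeedback, ← hS]
    congr 2
    ring
  set Z := E * proj π with hZ
  have hZZ : Z.transpose * Z = proj π * expFeedback π h * proj π := by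
    rw [hZ, Matrix.transpose_mul, hsymm.eq, (proj_isSymm π).eq, ← hEE]
    simp only [Matrix.mul_assoc]
  have htr : 0 ≤ (Z.transpose * Z).trace := by
    rw [Matrix.trace]
    refine Finset.sum_nonneg fun i _ => ?_
    rw [Matrix.diag_apply, Matrix.mul_apply]
    exact Finset.sum_nonneg fun j _ => mul_self_nonneg _
  refine ⟨√((Z.transpose * Z).trace⁻¹) • (Z * invSqrtWeight π), ?_⟩
  rw [embeddingGram, density, ← hZZ, Matrix.transpose_smul, Matrix.transpose_mul Z,
    (invSqrtWeight_isSymm π).eq, Matrix.smul_mul, Matrix.mul_smul, smul_smul,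
    Real.mul_self_sqrt (inv_nonneg.mpr htr), Matrix.mul_smul, Matrix.smul_mul]
  simp only [Matrix.mul_assoc]

/-- A Gram decomposition of `Y`: the vector `v i` is the column `i` of this matrix. -/
def embedding (π : V → ℝ) (h : History V) : Matrix V V ℝ := (exists_gram π h).choose

lemma embedding_spec (π : V → ℝ) (h : History V) :
    (embedding π h).transpose * embedding π h = embeddingGram π h := (exists_gram π h).choose_spec

/-- The (lower) median of the numbers `x i` with respect to `π`: the smallest number `x k` such
that the vertices `j` with `x j ≤ x k` have at least half of the total weight. -/
def weightedMedian (π : V → ℝ) (x : V → ℝ) : ℝ :=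
  sInf (x '' {k | weight π Finset.univ / 2 ≤ weight π {j | x j ≤ x k}})

/-- The side `L` of the cut at the weighted median. -/
def medianCut (π : V → ℝ) (x : V → ℝ) : Finset V := {i | x i ≤ weightedMedian π x}

lemma mem_medianCut (π : V → ℝ) (x : V → ℝ) (i : V) :
    i ∈ medianCut π x ↔ x i ≤ weightedMedian π x := by
  simp [medianCut]

/-- The standard Gaussian measure on `ℝ^V`. -/
def gaussian (V : Type*) [Fintype V] : Measure (V → ℝ) := Measure.pi fun _ => gaussianReal 0 1

lemma measurableSet_medianCut (π : V → ℝ) (S : Finset V) :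
    MeasurableSet {x : V → ℝ | medianCut π x = S} := by
  have hord : ∀ j k : V, MeasurableSet {x : V → ℝ | x j ≤ x k} := fun j k =>
    measurableSet_le (measurable_pi_apply j) (measurable_pi_apply k)
  have hF : ∀ (k : V) (F : Finset V),
      MeasurableSet {x : V → ℝ | (Finset.univ.filter fun j => x j ≤ x k) = F} := by
    intro k F
    have : {x : V → ℝ | (Finset.univ.filter fun j => x j ≤ x k) = F}
        = ⋂ j : V, {x : V → ℝ | x j ≤ x k ↔ j ∈ F} := by
      ext x
      simp [Finset.ext_iff]
    rw [this]
    refine MeasurableSet.iInter fun j => ?_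
    by_cases hj : j ∈ F
    · simpa [hj] using hord j k
    · simp only [hj, iff_false]
      exact (hord j k).compl
  have hhalf : ∀ k : V, MeasurableSet {x : V → ℝ |
      weight π Finset.univ / 2 ≤ weight π {j | x j ≤ x k}} := by
    intro k
    have : {x : V → ℝ | weight π Finset.univ / 2 ≤ weight π {j | x j ≤ x k}}
        = ⋃ F ∈ {F : Finset V | weight π Finset.univ / 2 ≤ weight π F},
          {x : V → ℝ | (Finset.univ.filter fun j => x j ≤ x k) = F} := by
      ext x
      simp
    rw [this]
    exact MeasurableSet.biUnion (Set.to_countable _) fun F _ => hF k F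
  have hK : ∀ K : Set V, MeasurableSet {x : V → ℝ |
      {k | weight π Finset.univ / 2 ≤ weight π {j | x j ≤ x k}} = K} := by
    intro K
    have : {x : V → ℝ | {k | weight π Finset.univ / 2 ≤ weight π {j | x j ≤ x k}} = K}
        = ⋂ k : V, {x : V → ℝ |
          weight π Finset.univ / 2 ≤ weight π {j | x j ≤ x k} ↔ k ∈ K} := by
      ext x
      simp [Set.ext_iff]
    rw [this]
    refine MeasurableSet.iInter fun k => ?_
    by_cases hk : k ∈ K
    · simpa only [hk, iff_true] using hhalf k
    · simp only [hk, iff_false]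
      exact (hhalf k).compl
  have hmed : ∀ (K : Set V) (i : V), MeasurableSet {x : V → ℝ | x i ≤ sInf (x '' K)} := by
    intro K i
    simp only [sInf_image']
    exact measurableSet_le (measurable_pi_apply i)
      (Measurable.iInf fun k => measurable_pi_apply _)
  have : {x : V → ℝ | medianCut π x = S} = ⋃ K : Set V,
      {x : V → ℝ | {k | weight π Finset.univ / 2 ≤ weight π {j | x j ≤ x k}} = K} ∩
        ⋂ i : V, {x : V → ℝ | x i ≤ sInf (x '' K) ↔ i ∈ S} := by
    ext x
    simp [Finset.ext_iff, mem_medianCut, weightedMedian]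
  rw [this]
  refine MeasurableSet.iUnion fun K => (hK K).inter (MeasurableSet.iInter fun i => ?_)
  by_cases hi : i ∈ S
  · simpa only [hi, iff_true] using hmed K i
  · simp only [hi, iff_false]
    exact (hmed K i).compl

lemma sum_gaussian_medianCut (π : V → ℝ) (B : Matrix V V ℝ) :
    ∑ S : Finset V, gaussian V {u | medianCut π (Matrix.vecMul u B) = S} = 1 := by
  have hB : Measurable fun u : V → ℝ => Matrix.vecMul u B := by
    refine measurable_pi_lambda _ fun i => ?_
    simp only [Matrix.vecMul, dotProduct]
    fun_prop
  have := sum_measure_preimage_singleton (μ := gaussian V) (Finset.univ : Finset (Finset V))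
    (f := fun u => medianCut π (Matrix.vecMul u B))
    fun S _ => hB (measurableSet_medianCut π S)
  have hp : IsProbabilityMeasure (gaussian V) := by unfold gaussian; infer_instance
  simpa [Set.preimage] using this

open Classical in
/-- The cut-player strategy. If some vertex carries a quarter of the total weight, cut off such a
vertex; otherwise project the embedding on a random Gaussian vector `u`, that is,
`x i = ⟨u, v i⟩`, and cut at the weighted median. -/
def mmwuStrategy (π : V → ℝ) : CutStrategy V := fun h =>
  if hi : ∃ i, weight π Finset.univ / 4 ≤ π i then PMF.pure {hi.choose}
  else PMF.ofFintype
    (fun L => gaussian V {u | medianCut π (Matrix.vecMul u (embedding π h)) = L})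
    (sum_gaussian_medianCut π (embedding π h))

/-- The number `⌈C log² n⌉` of rounds. -/
def rounds (C : ℝ) (n : ℕ) : ℕ := ⌈C * Real.log n ^ 2⌉₊

/-- The probability that after `T` rounds the union of the matchings is an Eulerian graph with
edge expansion at least `φ`. -/
def winProb (π : V → ℝ) (σ : CutStrategy V) (τ : MatchingStrategy V) (T : ℕ) (φ : ℝ) : ℝ≥0∞ :=
  (play σ τ T).toOuterMeasure {h | IsEulerian (union h) ∧ φ ≤ edgeExpansion π (union h)}

end CutMatching

end

/-!
The proof tracks the potential `tr (P E P)`, where `E` is the matrix exponential of the strategy.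
Since feedback matrices annihilate `Π^{1/2} 1`, the potential is `tr E - 1`.

*A small potential gives expansion.* By Jensen's inequality in an eigenbasis, the potential is at
least `exp (-(1 / 16) * q / ‖x‖²)` for every `x` orthogonal to `Π^{1/2} 1` on which the quadratic
form of the accumulated feedback has the value `q` (`exp_le_potential`). Applied to centred
indicator vectors, this turns a potential of at most `1 / n` into expansion `8 log n`
(`le_edgeExpansion_of_potential_le`).

*One round.* Subtracting a small positive semidefinite matrix `B` from the exponent decreases the
trace of the exponential by nearly `tr (e^A B)` (`trace_exp_sub_le`). This follows from Klein's
inequality and scalar inequalities for `exp`, by expanding all traces in the eigenbases of the two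
exponents. So the potential drops by a factor `1 - (7 / 144) tr (M X)`, where `M` is the feedback
of the new matching (`potential_append_le`), and `tr (M X)` is the energy of the embedding on the
edges of that matching.

*The energy of a matching.* Edges of the matching cross the median of the projected points, hence
the energy of the projection is at least a third of its weighted second moment, which is one in
expectation. Unless one of the `n²` differences of vectors is stretched by the projection by more
than `√(32 log n)`, the energy of the embedding is smaller by a factor of at most `32 log n`
(`truncatedMoment_le_loss`). Stretched differences account for less than half of the second moment,
by the Gaussian tail (`half_le_integral_truncatedMoment`).

Hence the expected potential drops by a factor `1 - Ω(1 / log n)` in every round, for every history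
and every answer (`tsum_mmwuStrategy_potential_le`). It starts at `n - 1`, and after `C log² n`
rounds Markov's inequality makes it at most `1 / n` with probability close to one. No independence
or concentration between the rounds is needed. With probability one the numbers compared by
the median are distinct, so both sides of the cut carry at least a quarter of the weight and, for
equal weights and even `n`, the cut is a bisection.

If some vertex is heavy, every answer is the same star, whose expansion is at least one. For four
vertices with equal weights, every set is split unevenly by enough of the three bisections in turn,
and a matching sends out of `S` at least the difference of the numbers of vertices of `S` on the two
sides (`imbalance_le_outWeight`).
-/

set_option linter.unusedSectionVars false

namespace CutMatching

open Matrix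

variable {V : Type*} [Fintype V] [DecidableEq V] {π : V → ℝ}

/-! ### Spectral decompositions of real symmetric matrices -/

/-- The symmetric matrix with orthonormal eigenvectors the columns of `U` (if `U` is orthogonal)
and eigenvalues `a`. -/
noncomputable def ofSpectrum (U : Matrix V V ℝ) (a : V → ℝ) : Matrix V V ℝ :=
  U * diagonal a * Uᵀ

lemma exists_eq_ofSpectrum {A : Matrix V V ℝ} (hA : A.IsSymm) :
    ∃ (U : Matrix V V ℝ) (a : V → ℝ), Uᵀ * U = 1 ∧ A = ofSpectrum U a := by
  have hH : A.IsHermitian := by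
    rwa [Matrix.IsHermitian, conjTranspose_eq_transpose_of_trivial]
  refine ⟨hH.eigenvectorUnitary, hH.eigenvalues, ?_, ?_⟩
  · have := (Matrix.mem_unitaryGroup_iff' (A := (hH.eigenvectorUnitary : Matrix V V ℝ))).1
      hH.eigenvectorUnitary.2
    rwa [star_eq_conjTranspose, conjTranspose_eq_transpose_of_trivial] at this
  · have := hH.spectral_theorem
    rw [Unitary.conjStarAlgAut_apply, star_eq_conjTranspose,
      conjTranspose_eq_transpose_of_trivial] at this
    exact this

lemma ofSpectrum_mul_ofSpectrum {U : Matrix V V ℝ} (hU : Uᵀ * U = 1) (f g : V → ℝ) :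
    ofSpectrum U f * ofSpectrum U g = ofSpectrum U fun i => f i * g i := by
  calc U * diagonal f * Uᵀ * (U * diagonal g * Uᵀ)
      = U * diagonal f * (Uᵀ * U) * diagonal g * Uᵀ := by simp only [Matrix.mul_assoc]
    _ = _ := by
      rw [hU, Matrix.mul_one, Matrix.mul_assoc U, diagonal_mul_diagonal, ofSpectrum]

lemma exp_ofSpectrum {U : Matrix V V ℝ} (hU : Uᵀ * U = 1) (a : V → ℝ) :
    NormedSpace.exp (ofSpectrum U a) = ofSpectrum U fun i => Real.exp (a i) := by
  have hinv : U⁻¹ = Uᵀ := Matrix.inv_eq_left_inv hU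
  have hunit : IsUnit U := (Matrix.isUnit_iff_isUnit_det U).2 (Matrix.isUnit_det_of_left_inverse hU)
  rw [ofSpectrum, ← hinv, Matrix.exp_conj U _ hunit, exp_diagonal, hinv, ofSpectrum]
  congr
  ext i
  rw [Pi.coe_exp, Real.exp_eq_exp_ℝ]

lemma dotProduct_ofSpectrum_mulVec (U : Matrix V V ℝ) (a x : V → ℝ) :
    x ⬝ᵥ ofSpectrum U a *ᵥ x = ∑ i, a i * (Uᵀ *ᵥ x) i ^ 2 := by
  rw [ofSpectrum, ← mulVec_mulVec, ← mulVec_mulVec, dotProduct_mulVec, ← mulVec_transpose,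
    dotProduct]
  refine Finset.sum_congr rfl fun i _ => ?_
  rw [mulVec_diagonal]
  ring

lemma trace_ofSpectrum {U : Matrix V V ℝ} (hU : Uᵀ * U = 1) (a : V → ℝ) :
    (ofSpectrum U a).trace = ∑ i, a i := by
  rw [ofSpectrum, trace_mul_comm, ← Matrix.mul_assoc, hU, Matrix.one_mul, trace_diagonal]

lemma trace_ofSpectrum_mul_ofSpectrum (U W : Matrix V V ℝ) (f g : V → ℝ) :
    (ofSpectrum U f * ofSpectrum W g).trace = ∑ i, ∑ j, (Uᵀ * W) i j ^ 2 * (f i * g j) := by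
  have : (ofSpectrum U f * ofSpectrum W g).trace
      = (diagonal f * (Uᵀ * W) * (diagonal g * (Uᵀ * W)ᵀ)).trace := by
    rw [ofSpectrum, ofSpectrum, transpose_mul, transpose_transpose]
    rw [show U * diagonal f * Uᵀ * (W * diagonal g * Wᵀ)
      = U * (diagonal f * Uᵀ * (W * diagonal g * Wᵀ)) by simp only [Matrix.mul_assoc],
      trace_mul_comm]
    simp only [Matrix.mul_assoc]
  rw [this, trace]
  refine Finset.sum_congr rfl fun i _ => ?_
  rw [diag_apply, mul_apply]
  refine Finset.sum_congr rfl fun j _ => ?_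
  rw [diagonal_mul, diagonal_mul, transpose_apply]
  ring

section Overlap

variable {U W : Matrix V V ℝ}

/-- The squared entries of `Uᵀ W` form a doubly stochastic matrix. -/
lemma sum_overlap_right (hU : Uᵀ * U = 1) (hW : Wᵀ * W = 1) (i : V) :
    ∑ j, (Uᵀ * W) i j ^ 2 = 1 := by
  have h : (Uᵀ * W) * (Uᵀ * W)ᵀ = 1 := by
    rw [transpose_mul, transpose_transpose, Matrix.mul_assoc, ← Matrix.mul_assoc W,
      mul_eq_one_comm.1 hW, Matrix.one_mul, hU]
  have := congr_fun (congr_fun h i) i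
  rw [mul_apply, one_apply_eq] at this
  rw [← this]
  exact Finset.sum_congr rfl fun j _ => by rw [transpose_apply]; ring

lemma sum_overlap_left (hU : Uᵀ * U = 1) (hW : Wᵀ * W = 1) (j : V) :
    ∑ i, (Uᵀ * W) i j ^ 2 = 1 := by
  rw [← sum_overlap_right hW hU j]
  refine Finset.sum_congr rfl fun i _ => ?_
  rw [← transpose_apply (Wᵀ * U), transpose_mul, transpose_transpose]

lemma trace_ofSpectrum_left_eq (hU : Uᵀ * U = 1) (hW : Wᵀ * W = 1) (f : V → ℝ) :
    (ofSpectrum U f).trace = ∑ i, ∑ j, (Uᵀ * W) i j ^ 2 * f i := by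
  rw [trace_ofSpectrum hU]
  refine Finset.sum_congr rfl fun i _ => ?_
  rw [← Finset.sum_mul, sum_overlap_right hU hW, one_mul]

lemma trace_ofSpectrum_right_eq (hU : Uᵀ * U = 1) (hW : Wᵀ * W = 1) (g : V → ℝ) :
    (ofSpectrum W g).trace = ∑ i, ∑ j, (Uᵀ * W) i j ^ 2 * g j := by
  rw [trace_ofSpectrum hW, Finset.sum_comm]
  refine Finset.sum_congr rfl fun i _ => ?_
  rw [← Finset.sum_mul, sum_overlap_left hU hW, one_mul]

end Overlap

/-! ### One step of the matrix multiplicative weight update -/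

/-- If `0 ≤ B ≤ β` in the Loewner order, then so are the eigenvalues of `B`, which compares the
traces of `e^A B²` and `e^A B`. -/
lemma trace_exp_mul_sq_le {A B : Matrix V V ℝ} (hA : A.IsSymm) (hB : B.IsSymm) {β : ℝ}
    (h0 : ∀ x, 0 ≤ x ⬝ᵥ B *ᵥ x) (h1 : ∀ x, x ⬝ᵥ B *ᵥ x ≤ β * (x ⬝ᵥ x)) :
    (NormedSpace.exp A * (B * B)).trace ≤ β * (NormedSpace.exp A * B).trace := by
  obtain ⟨U, a, hU, rfl⟩ := exists_eq_ofSpectrum hA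
  obtain ⟨W, b, hW, rfl⟩ := exists_eq_ofSpectrum hB
  have hcol : ∀ i j, (Wᵀ *ᵥ W.col j) i = if i = j then 1 else 0 := by
    intro i j
    have := congr_fun (congr_fun hW i) j
    rwa [mul_apply, one_apply] at this
  have hquad : ∀ j, W.col j ⬝ᵥ ofSpectrum W b *ᵥ W.col j = b j := by
    intro j
    rw [dotProduct_ofSpectrum_mulVec]
    simp [hcol]
  have hnorm : ∀ j, W.col j ⬝ᵥ W.col j = 1 := fun j => (hcol j j).trans (if_pos rfl)
  have hb0 : ∀ j, 0 ≤ b j := fun j => hquad j ▸ h0 (W.col j)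
  have hb1 : ∀ j, b j ≤ β := fun j => by
    have := h1 (W.col j)
    rwa [hquad, hnorm, mul_one] at this
  rw [ofSpectrum_mul_ofSpectrum hW, exp_ofSpectrum hU, trace_ofSpectrum_mul_ofSpectrum,
    trace_ofSpectrum_mul_ofSpectrum, Finset.mul_sum]
  refine Finset.sum_le_sum fun i _ => ?_
  rw [Finset.mul_sum]
  refine Finset.sum_le_sum fun j _ => ?_
  have h2 : 0 ≤ (Uᵀ * W) i j ^ 2 * Real.exp (a i) * b j :=
    mul_nonneg (mul_nonneg (sq_nonneg _) (Real.exp_pos _).le) (hb0 j)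
  nlinarith [mul_le_mul_of_nonneg_left (hb1 j) h2]

/-- Klein's inequality for the exponential function. -/
lemma trace_exp_mul_sub_le {A H : Matrix V V ℝ} (hA : A.IsSymm) (hH : H.IsSymm) :
    (NormedSpace.exp H * (A - H)).trace
      ≤ (NormedSpace.exp A).trace - (NormedSpace.exp H).trace := by
  obtain ⟨U, a, hU, rfl⟩ := exists_eq_ofSpectrum hA
  obtain ⟨W, b, hW, rfl⟩ := exists_eq_ofSpectrum hH
  rw [Matrix.mul_sub, trace_sub, exp_ofSpectrum hU, exp_ofSpectrum hW,
    trace_mul_comm (ofSpectrum W _) (ofSpectrum U a), trace_ofSpectrum_mul_ofSpectrum,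
    ofSpectrum_mul_ofSpectrum hW, trace_ofSpectrum_left_eq hU hW, trace_ofSpectrum_right_eq hU hW,
    trace_ofSpectrum_right_eq hU hW]
  simp only [← Finset.sum_sub_distrib]
  refine Finset.sum_le_sum fun i _ => Finset.sum_le_sum fun j _ => ?_
  have h := Real.add_one_le_exp (a i - b j)
  rw [Real.exp_sub, le_div_iff₀ (Real.exp_pos _)] at h
  nlinarith [mul_le_mul_of_nonneg_left h (sq_nonneg ((Uᵀ * W) i j))]

/-- In the two eigenbases this is the scalar inequality
`(eᵃ - eᵇ) (a - b) ≤ (a - b)² (eᵃ + eᵇ)`. -/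
lemma trace_exp_sub_exp_mul_le {A H : Matrix V V ℝ} (hA : A.IsSymm) (hH : H.IsSymm) :
    (NormedSpace.exp A * (A - H)).trace - (NormedSpace.exp H * (A - H)).trace
      ≤ (NormedSpace.exp A * ((A - H) * (A - H))).trace
        + (NormedSpace.exp H * ((A - H) * (A - H))).trace := by
  obtain ⟨U, a, hU, rfl⟩ := exists_eq_ofSpectrum hA
  obtain ⟨W, b, hW, rfl⟩ := exists_eq_ofSpectrum hH
  have hcomm : ∀ X Y Z : Matrix V V ℝ, (X * (Y * Z)).trace = (Z * X * Y).trace := by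
    intro X Y Z
    rw [← Matrix.mul_assoc, trace_mul_comm, Matrix.mul_assoc]
  have hA1 : ∀ f : V → ℝ, (ofSpectrum U f * (ofSpectrum U a - ofSpectrum W b)).trace
      = ∑ i, ∑ j, (Uᵀ * W) i j ^ 2 * (f i * (a i - b j)) := by
    intro f
    rw [Matrix.mul_sub, trace_sub, ofSpectrum_mul_ofSpectrum hU, trace_ofSpectrum_left_eq hU hW,
      trace_ofSpectrum_mul_ofSpectrum]
    simp only [← Finset.sum_sub_distrib, mul_sub]
  have hH1 : ∀ f : V → ℝ, (ofSpectrum W f * (ofSpectrum U a - ofSpectrum W b)).trace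
      = ∑ i, ∑ j, (Uᵀ * W) i j ^ 2 * (f j * (a i - b j)) := by
    intro f
    rw [Matrix.mul_sub, trace_sub, ofSpectrum_mul_ofSpectrum hW, trace_ofSpectrum_right_eq hU hW,
      trace_mul_comm, trace_ofSpectrum_mul_ofSpectrum]
    simp only [← Finset.sum_sub_distrib, mul_sub]
    exact Finset.sum_congr rfl fun i _ => Finset.sum_congr rfl fun j _ => by ring
  have hA2 : ∀ f : V → ℝ, (ofSpectrum U f * ((ofSpectrum U a - ofSpectrum W b) *
      (ofSpectrum U a - ofSpectrum W b))).trace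
      = ∑ i, ∑ j, (Uᵀ * W) i j ^ 2 * (f i * (a i - b j) ^ 2) := by
    intro f
    simp only [Matrix.mul_sub, Matrix.sub_mul, trace_sub]
    rw [hcomm _ (ofSpectrum W b) (ofSpectrum U a)]
    rw [← Matrix.mul_assoc _ (ofSpectrum U a) (ofSpectrum W b)]
    simp only [ofSpectrum_mul_ofSpectrum hU, ofSpectrum_mul_ofSpectrum hW]
    rw [trace_ofSpectrum_left_eq hU hW]
    simp only [trace_ofSpectrum_mul_ofSpectrum, ← Finset.sum_sub_distrib]
    exact Finset.sum_congr rfl fun i _ => Finset.sum_congr rfl fun j _ => by ring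
  have hH2 : ∀ f : V → ℝ, (ofSpectrum W f * ((ofSpectrum U a - ofSpectrum W b) *
      (ofSpectrum U a - ofSpectrum W b))).trace
      = ∑ i, ∑ j, (Uᵀ * W) i j ^ 2 * (f j * (a i - b j) ^ 2) := by
    intro f
    simp only [Matrix.mul_sub, Matrix.sub_mul, trace_sub]
    rw [hcomm _ (ofSpectrum U a) (ofSpectrum W b)]
    rw [← Matrix.mul_assoc _ (ofSpectrum W b) (ofSpectrum U a)]
    simp only [ofSpectrum_mul_ofSpectrum hU, ofSpectrum_mul_ofSpectrum hW]
    rw [trace_ofSpectrum_right_eq hU hW]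
    simp only [trace_mul_comm (ofSpectrum W _) (ofSpectrum U _)]
    simp only [trace_ofSpectrum_mul_ofSpectrum, ← Finset.sum_sub_distrib]
    exact Finset.sum_congr rfl fun i _ => Finset.sum_congr rfl fun j _ => by ring
  rw [exp_ofSpectrum hU, exp_ofSpectrum hW, hA1, hH1, hA2, hH2]
  simp only [← Finset.sum_sub_distrib, ← Finset.sum_add_distrib]
  refine Finset.sum_le_sum fun i _ => Finset.sum_le_sum fun j _ => ?_
  have hscalar : ∀ s t : ℝ, t ≤ s →
      (Real.exp s - Real.exp t) * (s - t) ≤ (s - t) ^ 2 * (Real.exp s + Real.exp t) := by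
    intro s t hst
    have h := Real.add_one_le_exp (t - s)
    rw [Real.exp_sub, le_div_iff₀ (Real.exp_pos _)] at h
    nlinarith [mul_nonneg (sub_nonneg.2 hst) (sub_nonneg.2 h),
      mul_nonneg (sq_nonneg (s - t)) (Real.exp_pos t).le]
  have h : (Real.exp (a i) - Real.exp (b j)) * (a i - b j)
      ≤ (a i - b j) ^ 2 * (Real.exp (a i) + Real.exp (b j)) := by
    rcases le_total (b j) (a i) with h | h
    · exact hscalar _ _ h
    · linarith [hscalar _ _ h]
  nlinarith [mul_le_mul_of_nonneg_left h (sq_nonneg ((Uᵀ * W) i j))]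

/-- Decreasing the exponent by a small positive semidefinite matrix decreases the trace of the
exponential almost as much as to first order. This takes the place of the Golden–Thompson
inequality in the usual analysis. -/
theorem trace_exp_sub_le {A B : Matrix V V ℝ} (hA : A.IsSymm) (hB : B.IsSymm) {β : ℝ}
    (hβ : 0 ≤ β) (h0 : ∀ x, 0 ≤ x ⬝ᵥ B *ᵥ x) (h1 : ∀ x, x ⬝ᵥ B *ᵥ x ≤ β * (x ⬝ᵥ x)) :
    (1 - β) * (NormedSpace.exp A * B).trace
      ≤ (1 + β) * ((NormedSpace.exp A).trace - (NormedSpace.exp (A - B)).trace) := by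
  have hH : (A - B).IsSymm := hA.sub hB
  have hklein := trace_exp_mul_sub_le hA hH
  have hdiff := trace_exp_sub_exp_mul_le hA hH
  have hsqA := trace_exp_mul_sq_le hA hB h0 h1
  have hsqH := trace_exp_mul_sq_le hH hB h0 h1
  rw [sub_sub_cancel] at hklein hdiff
  nlinarith [mul_le_mul_of_nonneg_left hklein (by linarith : 0 ≤ 1 + β)]

/-! ### Quadratic forms of the matrix exponential -/

lemma sum_sq_transpose_mulVec {U : Matrix V V ℝ} (hU : Uᵀ * U = 1) (x : V → ℝ) :
    ∑ i, (Uᵀ *ᵥ x) i ^ 2 = x ⬝ᵥ x := by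
  calc ∑ i, (Uᵀ *ᵥ x) i ^ 2 = (Uᵀ *ᵥ x) ⬝ᵥ (Uᵀ *ᵥ x) :=
        Finset.sum_congr rfl fun i _ => by ring
    _ = x ⬝ᵥ x := by
      rw [dotProduct_mulVec, ← mulVec_transpose, transpose_transpose, mulVec_mulVec,
        mul_eq_one_comm.1 hU, one_mulVec]

lemma exp_dotProduct_mulVec_le {A : Matrix V V ℝ} (hA : A.IsSymm) {x : V → ℝ}
    (hx : x ⬝ᵥ x = 1) : Real.exp (x ⬝ᵥ A *ᵥ x) ≤ x ⬝ᵥ NormedSpace.exp A *ᵥ x := by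
  obtain ⟨U, a, hU, rfl⟩ := exists_eq_ofSpectrum hA
  rw [exp_ofSpectrum hU, dotProduct_ofSpectrum_mulVec, dotProduct_ofSpectrum_mulVec]
  have := convexOn_exp.map_sum_le (t := Finset.univ) (w := fun i => (Uᵀ *ᵥ x) i ^ 2) (p := a)
    (fun i _ => sq_nonneg _) (by rw [sum_sq_transpose_mulVec hU, hx]) (fun i _ => Set.mem_univ _)
  simpa only [smul_eq_mul, mul_comm] using this

lemma eq_zero_of_dotProduct_exp_mulVec_eq_zero {A : Matrix V V ℝ} (hA : A.IsSymm) {x : V → ℝ}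
    (hx : x ⬝ᵥ NormedSpace.exp A *ᵥ x = 0) : x = 0 := by
  obtain ⟨U, a, hU, rfl⟩ := exists_eq_ofSpectrum hA
  rw [exp_ofSpectrum hU, dotProduct_ofSpectrum_mulVec, Finset.sum_eq_zero_iff_of_nonneg
    fun i _ => mul_nonneg (Real.exp_pos _).le (sq_nonneg _)] at hx
  rw [← dotProduct_self_eq_zero, ← sum_sq_transpose_mulVec hU]
  exact Finset.sum_eq_zero fun i hi =>
    (mul_eq_zero.1 (hx i hi)).resolve_left (Real.exp_pos _).ne'

lemma exp_mulVec_of_mulVec_eq_zero {A : Matrix V V ℝ} (hA : A.IsSymm) {x : V → ℝ}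
    (hx : A *ᵥ x = 0) : NormedSpace.exp A *ᵥ x = x := by
  obtain ⟨U, a, hU, rfl⟩ := exists_eq_ofSpectrum hA
  have hz : ∀ i, a i * (Uᵀ *ᵥ x) i = 0 := by
    intro i
    have : Uᵀ *ᵥ (ofSpectrum U a *ᵥ x) = diagonal a *ᵥ (Uᵀ *ᵥ x) := by
      rw [ofSpectrum, mulVec_mulVec, Matrix.mul_assoc, ← Matrix.mul_assoc, hU, Matrix.one_mul,
        mulVec_mulVec]
    rw [hx, mulVec_zero] at this
    simpa [mulVec_diagonal] using (congr_fun this i).symm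
  have : diagonal (fun i => Real.exp (a i)) *ᵥ (Uᵀ *ᵥ x) = Uᵀ *ᵥ x := by
    ext i
    rw [mulVec_diagonal]
    rcases mul_eq_zero.1 (hz i) with h | h
    · simp [h]
    · simp [h]
  rw [exp_ofSpectrum hU, ofSpectrum, ← mulVec_mulVec, ← mulVec_mulVec, this, mulVec_mulVec,
    mul_eq_one_comm.1 hU, one_mulVec]

/-- Bessel's inequality in every eigenvector of the exponential. -/
lemma dotProduct_exp_add_le_trace {A : Matrix V V ℝ} (hA : A.IsSymm) {x w : V → ℝ}
    (hx : x ⬝ᵥ x = 1) (hw : w ⬝ᵥ w = 1) (hxw : x ⬝ᵥ w = 0) :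
    x ⬝ᵥ NormedSpace.exp A *ᵥ x + w ⬝ᵥ NormedSpace.exp A *ᵥ w ≤ (NormedSpace.exp A).trace := by
  obtain ⟨U, a, hU, rfl⟩ := exists_eq_ofSpectrum hA
  rw [exp_ofSpectrum hU, dotProduct_ofSpectrum_mulVec, dotProduct_ofSpectrum_mulVec,
    trace_ofSpectrum hU, ← Finset.sum_add_distrib]
  refine Finset.sum_le_sum fun i _ => ?_
  have hbessel : (Uᵀ *ᵥ x) i ^ 2 + (Uᵀ *ᵥ w) i ^ 2 ≤ 1 := by
    set u : V → ℝ := Uᵀ i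
    have huu : u ⬝ᵥ u = 1 := by
      have := congr_fun (congr_fun hU i) i
      rwa [mul_apply, one_apply_eq] at this
    change (u ⬝ᵥ x) ^ 2 + (u ⬝ᵥ w) ^ 2 ≤ 1
    have h : 0 ≤ (u - (u ⬝ᵥ x) • x - (u ⬝ᵥ w) • w) ⬝ᵥ (u - (u ⬝ᵥ x) • x - (u ⬝ᵥ w) • w) :=
      Finset.sum_nonneg fun _ _ => mul_self_nonneg _
    simp only [sub_dotProduct, dotProduct_sub, smul_dotProduct, dotProduct_smul, smul_eq_mul,
      hx, hw, huu, hxw, dotProduct_comm w x, dotProduct_comm x u, dotProduct_comm w u] at h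
    nlinarith
  nlinarith [mul_le_mul_of_nonneg_left hbessel (Real.exp_pos (a i)).le]

/-! ### Laplacians and feedback matrices -/

lemma dotProduct_symLaplacian_mulVec (D : Matrix V V ℝ) (x : V → ℝ) :
    x ⬝ᵥ symLaplacian D *ᵥ x = 1 / 2 * ∑ i, ∑ j, D i j * (x i - x j) ^ 2 := by
  have h1 : x ⬝ᵥ diagonal (fun i => ∑ j, (D i j + D j i) / 2) *ᵥ x
      = 1 / 2 * (∑ i, ∑ j, D i j * x i ^ 2) + 1 / 2 * ∑ i, ∑ j, D i j * x j ^ 2 := by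
    rw [Finset.sum_comm (f := fun i j => D i j * x j ^ 2), ← mul_add, ← Finset.sum_add_distrib,
      Finset.mul_sum, dotProduct]
    refine Finset.sum_congr rfl fun i _ => ?_
    rw [mulVec_diagonal, ← Finset.sum_add_distrib, Finset.sum_mul, Finset.mul_sum, Finset.mul_sum]
    exact Finset.sum_congr rfl fun j _ => by ring
  have h2 : x ⬝ᵥ (D *ᵥ x) = ∑ i, ∑ j, D i j * (x i * x j) := by
    simp only [dotProduct, mulVec, Finset.mul_sum]
    exact Finset.sum_congr rfl fun i _ => Finset.sum_congr rfl fun j _ => by ring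
  have h3 : x ⬝ᵥ (Dᵀ *ᵥ x) = x ⬝ᵥ (D *ᵥ x) := by
    rw [mulVec_transpose, dotProduct_comm, dotProduct_mulVec]
  rw [symLaplacian, sub_mulVec, dotProduct_sub, smul_mulVec, dotProduct_smul, add_mulVec,
    dotProduct_add, h1, h3, h2, smul_eq_mul]
  simp only [Finset.mul_sum, ← Finset.sum_add_distrib, ← Finset.sum_sub_distrib]
  exact Finset.sum_congr rfl fun i _ => Finset.sum_congr rfl fun j _ => by ring

lemma symLaplacian_add (A D : Matrix V V ℝ) :
    symLaplacian (A + D) = symLaplacian A + symLaplacian D := by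
  ext i j
  simp only [symLaplacian, Matrix.sub_apply, Matrix.add_apply, Matrix.smul_apply,
    transpose_apply, diagonal_apply]
  split_ifs with h
  · have : ∑ k, (A i k + D i k + (A k i + D k i)) / 2
        = ∑ k, (A i k + A k i) / 2 + ∑ k, (D i k + D k i) / 2 := by
      rw [← Finset.sum_add_distrib]
      exact Finset.sum_congr rfl fun k _ => by ring
    simp only [this, smul_eq_mul]
    ring
  · simp only [smul_eq_mul]
    ring

lemma symLaplacian_zero : symLaplacian (0 : Matrix V V ℝ) = 0 := by
  have := symLaplacian_add (0 : Matrix V V ℝ) 0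
  rwa [add_zero, left_eq_add] at this

lemma symLaplacian_mulVec_one (D : Matrix V V ℝ) : symLaplacian D *ᵥ (fun _ => 1) = 0 := by
  ext i
  simp only [symLaplacian, sub_mulVec, smul_mulVec, Pi.sub_apply, mulVec_diagonal, Pi.smul_apply,
    Pi.zero_apply, mul_one]
  simp only [mulVec, dotProduct, mul_one, Matrix.add_apply, transpose_apply, smul_eq_mul,
    ← Finset.sum_div]
  ring

lemma sum_map_feedback (π : V → ℝ) (l : List (Matrix V V ℝ)) :
    (l.map (feedback π)).sum = feedback π l.sum := by
  induction l with
  | nil => simp [feedback, symLaplacian_zero]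
  | cons a l ih =>
    simp only [List.map_cons, List.sum_cons, ih, feedback, symLaplacian_add, Matrix.mul_add,
      Matrix.add_mul]

lemma expFeedback_eq (π : V → ℝ) (h : History V) :
    expFeedback π h = NormedSpace.exp (-(1 / 16 : ℝ) • feedback π (union h)) := by
  rw [expFeedback, sum_map_feedback, union]
  norm_num [stepSize, width]

lemma smul_feedback_isSymm (c : ℝ) (π : V → ℝ) (D : Matrix V V ℝ) :
    (c • feedback π D).IsSymm := (feedback_isSymm π D).smul c

lemma invSqrtWeight_mulVec (π x : V → ℝ) (i : V) :
    (invSqrtWeight π *ᵥ x) i = (√(π i))⁻¹ * x i := by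
  rw [invSqrtWeight, mulVec_diagonal]

lemma dotProduct_invSqrtWeight_conj (π x : V → ℝ) (M : Matrix V V ℝ) :
    x ⬝ᵥ (invSqrtWeight π * M * invSqrtWeight π) *ᵥ x
      = (invSqrtWeight π *ᵥ x) ⬝ᵥ M *ᵥ (invSqrtWeight π *ᵥ x) := by
  rw [← mulVec_mulVec, ← mulVec_mulVec, dotProduct_mulVec, ← mulVec_transpose,
    (invSqrtWeight_isSymm π).eq]

lemma dotProduct_feedback_mulVec (π : V → ℝ) (D : Matrix V V ℝ) (x : V → ℝ) :
    x ⬝ᵥ feedback π D *ᵥ x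
      = 1 / 2 * ∑ i, ∑ j, D i j * ((√(π i))⁻¹ * x i - (√(π j))⁻¹ * x j) ^ 2 := by
  rw [feedback, dotProduct_invSqrtWeight_conj, dotProduct_symLaplacian_mulVec]
  simp only [invSqrtWeight_mulVec]

lemma dotProduct_feedback_mulVec_nonneg (π : V → ℝ) {D : Matrix V V ℝ} (hD : ∀ i j, 0 ≤ D i j)
    (x : V → ℝ) : 0 ≤ x ⬝ᵥ feedback π D *ᵥ x := by
  rw [dotProduct_feedback_mulVec]
  exact mul_nonneg (by norm_num) (Finset.sum_nonneg fun i _ => Finset.sum_nonneg fun j _ =>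
    mul_nonneg (hD i j) (sq_nonneg _))

lemma feedback_mulVec_sqrt (hπ : ∀ i, 0 < π i) (D : Matrix V V ℝ) :
    feedback π D *ᵥ (fun i => √(π i)) = 0 := by
  have : invSqrtWeight π *ᵥ (fun i => √(π i)) = fun _ => 1 := by
    ext i
    rw [invSqrtWeight_mulVec, inv_mul_cancel₀ (Real.sqrt_pos.2 (hπ i)).ne']
  rw [feedback, ← mulVec_mulVec, ← mulVec_mulVec, this, symLaplacian_mulVec_one, mulVec_zero]

lemma sum_sum_mul_add_eq (D : Matrix V V ℝ) (f : V → ℝ) :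
    ∑ i, ∑ j, D i j * (f i + f j) = ∑ i, (∑ j, D i j + ∑ j, D j i) * f i := by
  simp only [mul_add, Finset.sum_add_distrib]
  rw [Finset.sum_comm (f := fun i j => D i j * f j), ← Finset.sum_add_distrib]
  refine Finset.sum_congr rfl fun i _ => ?_
  rw [add_mul, Finset.sum_mul, Finset.sum_mul]

/-- The largest eigenvalue of the feedback is at most twice the maximum degree relative to the
weights. -/
lemma dotProduct_feedback_mulVec_le (hπ : ∀ i, 0 < π i) {D : Matrix V V ℝ}
    (hD : ∀ i j, 0 ≤ D i j) (hout : ∀ i, ∑ j, D i j ≤ π i) (hin : ∀ i, ∑ j, D j i ≤ π i)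
    (x : V → ℝ) : x ⬝ᵥ feedback π D *ᵥ x ≤ 2 * (x ⬝ᵥ x) := by
  rw [dotProduct_feedback_mulVec]
  set y : V → ℝ := fun i => (√(π i))⁻¹ * x i with hy
  have h1 : ∑ i, ∑ j, D i j * (y i - y j) ^ 2
      ≤ ∑ i, ∑ j, D i j * (2 * y i ^ 2 + 2 * y j ^ 2) :=
    Finset.sum_le_sum fun i _ => Finset.sum_le_sum fun j _ =>
      mul_le_mul_of_nonneg_left (by nlinarith [sq_nonneg (y i + y j)]) (hD i j)
  rw [sum_sum_mul_add_eq D fun i => 2 * y i ^ 2] at h1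
  have h2 : ∑ i, (∑ j, D i j + ∑ j, D j i) * (2 * y i ^ 2) ≤ ∑ i, 4 * (x i * x i) := by
    refine Finset.sum_le_sum fun i _ => ?_
    have h3 : π i * y i ^ 2 = x i * x i := by
      have := Real.sq_sqrt (hπ i).le
      have h0 := (Real.sqrt_pos.2 (hπ i)).ne'
      rw [hy]
      field_simp
      rw [this]
    nlinarith [mul_le_mul_of_nonneg_right (add_le_add (hout i) (hin i)) (sq_nonneg (y i))]
  rw [← Finset.mul_sum] at h2
  rw [dotProduct]
  linarith

/-! ### The potential -/

/-- The potential of the multiplicative weight update, which is the trace of the matrix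
exponential on the complement of `Π^{1/2} 1`, where the exponential has eigenvalue one. -/
noncomputable def potential (π : V → ℝ) (h : History V) : ℝ := (expFeedback π h).trace - 1

lemma sqrt_dotProduct_sqrt (hπ : ∀ i, 0 < π i) :
    (fun i => √(π i)) ⬝ᵥ (fun i => √(π i)) = weight π Finset.univ :=
  Finset.sum_congr rfl fun i _ => Real.mul_self_sqrt (hπ i).le

lemma weight_univ_pos [Nonempty V] (hπ : ∀ i, 0 < π i) : 0 < weight π Finset.univ :=
  Finset.sum_pos (fun i _ => hπ i) Finset.univ_nonempty

lemma expFeedback_mulVec_sqrt (hπ : ∀ i, 0 < π i) (h : History V) :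
    expFeedback π h *ᵥ (fun i => √(π i)) = fun i => √(π i) := by
  rw [expFeedback_eq]
  refine exp_mulVec_of_mulVec_eq_zero (smul_feedback_isSymm _ _ _) ?_
  rw [smul_mulVec, feedback_mulVec_sqrt hπ, smul_zero]

lemma proj_mulVec (π x : V → ℝ) : proj π *ᵥ x
    = x - ((weight π Finset.univ)⁻¹ * ((fun i => √(π i)) ⬝ᵥ x)) • fun i => √(π i) := by
  rw [proj, sub_mulVec, one_mulVec, smul_mulVec, vecMulVec_mulVec, op_smul_eq_smul, smul_smul]

lemma proj_mulVec_sqrt [Nonempty V] (hπ : ∀ i, 0 < π i) :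
    proj π *ᵥ (fun i => √(π i)) = 0 := by
  rw [proj_mulVec, sqrt_dotProduct_sqrt hπ, inv_mul_cancel₀ (weight_univ_pos hπ).ne', one_smul,
    sub_self]

lemma mul_proj_of_mulVec_sqrt {M : Matrix V V ℝ} (hM : M *ᵥ (fun i => √(π i)) = 0) :
    M * proj π = M := by
  rw [proj, Matrix.mul_sub, Matrix.mul_one, Matrix.mul_smul, mul_vecMulVec, hM]
  simp

lemma proj_mul_proj [Nonempty V] (hπ : ∀ i, 0 < π i) : proj π * proj π = proj π :=
  mul_proj_of_mulVec_sqrt (proj_mulVec_sqrt hπ)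

lemma trace_proj_mul_expFeedback_mul_proj [Nonempty V] (hπ : ∀ i, 0 < π i) (h : History V) :
    (proj π * expFeedback π h * proj π).trace = potential π h := by
  rw [trace_mul_comm, ← Matrix.mul_assoc, proj_mul_proj hπ, trace_mul_comm, proj,
    Matrix.mul_sub, Matrix.mul_one, Matrix.mul_smul, mul_vecMulVec, expFeedback_mulVec_sqrt hπ,
    trace_sub, trace_smul, trace_vecMulVec, sqrt_dotProduct_sqrt hπ, smul_eq_mul,
    inv_mul_cancel₀ (weight_univ_pos hπ).ne', potential]

/-- The potential bounds the spectral gap of the union of the matchings. -/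
lemma exp_le_potential [Nonempty V] (hπ : ∀ i, 0 < π i) (h : History V) {x : V → ℝ}
    (hx0 : 0 < x ⬝ᵥ x) (hx : x ⬝ᵥ (fun i => √(π i)) = 0) :
    Real.exp (-(1 / 16) * (x ⬝ᵥ feedback π (union h) *ᵥ x) / (x ⬝ᵥ x)) ≤ potential π h := by
  have hW := weight_univ_pos hπ
  set r := √(x ⬝ᵥ x)
  set R := √(weight π Finset.univ)
  have hr : 0 < r := Real.sqrt_pos.2 hx0
  have hR : 0 < R := Real.sqrt_pos.2 hW
  have hr2 : r * r = x ⬝ᵥ x := Real.mul_self_sqrt hx0.le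
  have hR2 : R * R = weight π Finset.univ := Real.mul_self_sqrt hW.le
  have h1 : (r⁻¹ • x) ⬝ᵥ (r⁻¹ • x) = 1 := by
    rw [smul_dotProduct, dotProduct_smul, smul_eq_mul, smul_eq_mul, ← hr2]
    field_simp
  have h2 : (R⁻¹ • fun i => √(π i)) ⬝ᵥ (R⁻¹ • fun i => √(π i)) = 1 := by
    rw [smul_dotProduct, dotProduct_smul, smul_eq_mul, smul_eq_mul, sqrt_dotProduct_sqrt hπ, ← hR2]
    field_simp
  have h3 : (r⁻¹ • x) ⬝ᵥ (R⁻¹ • fun i => √(π i)) = 0 := by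
    rw [smul_dotProduct, dotProduct_smul, hx, smul_zero, smul_zero]
  have hsymm := smul_feedback_isSymm (-(1 / 16)) π (union h)
  have h4 := dotProduct_exp_add_le_trace hsymm h1 h2 h3
  have h5 := exp_dotProduct_mulVec_le hsymm h1
  rw [← expFeedback_eq] at h4 h5
  have h6 : (R⁻¹ • fun i => √(π i)) ⬝ᵥ expFeedback π h *ᵥ (R⁻¹ • fun i => √(π i)) = 1 := by
    rw [mulVec_smul, expFeedback_mulVec_sqrt hπ, h2]
  have h7 : (r⁻¹ • x) ⬝ᵥ (-(1 / 16 : ℝ) • feedback π (union h)) *ᵥ (r⁻¹ • x)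
      = -(1 / 16) * (x ⬝ᵥ feedback π (union h) *ᵥ x) / (x ⬝ᵥ x) := by
    rw [smul_mulVec, mulVec_smul, smul_dotProduct, dotProduct_smul, dotProduct_smul, ← hr2]
    simp only [smul_eq_mul]
    field_simp
  rw [h7] at h5
  rw [potential]
  linarith

lemma potential_pos [Nontrivial V] (hπ : ∀ i, 0 < π i) (h : History V) : 0 < potential π h := by
  obtain ⟨i, j, hij⟩ := exists_pair_ne V
  -- A nonzero vector orthogonal to `Π^{1/2} 1`.
  set x : V → ℝ := Pi.single i √(π j) - Pi.single j √(π i) with hx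
  have hxi : x i = √(π j) := by simp [hx, hij]
  refine (Real.exp_pos _).trans_le (exp_le_potential hπ h (x := x) ?_ ?_)
  · refine Finset.sum_pos' (fun _ _ => mul_self_nonneg _) ⟨i, Finset.mem_univ i, ?_⟩
    rw [hxi]
    exact mul_pos (Real.sqrt_pos.2 (hπ j)) (Real.sqrt_pos.2 (hπ j))
  · rw [hx, sub_dotProduct, single_dotProduct, single_dotProduct]
    ring

lemma trace_feedback_mul_density [Nontrivial V] (hπ : ∀ i, 0 < π i) (h : History V)
    (D : Matrix V V ℝ) : (expFeedback π h * feedback π D).trace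
      = potential π h * (feedback π D * density π h).trace := by
  have hM := mul_proj_of_mulVec_sqrt (feedback_mulVec_sqrt hπ D)
  have hM' : proj π * feedback π D = feedback π D := by
    have := congr_arg transpose hM
    rwa [transpose_mul, (proj_isSymm π).eq, (feedback_isSymm π D).eq] at this
  have : (feedback π D * (proj π * expFeedback π h * proj π)).trace
      = (expFeedback π h * feedback π D).trace := by
    rw [← Matrix.mul_assoc, trace_mul_comm, ← Matrix.mul_assoc (feedback π D),
      hM, ← Matrix.mul_assoc, hM', trace_mul_comm]
  rw [density, trace_proj_mul_expFeedback_mul_proj hπ, Matrix.mul_smul, trace_smul, this,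
    smul_eq_mul, mul_inv_cancel_left₀ (potential_pos hπ h).ne']

lemma union_append (h : History V) (e : Finset V × Matrix V V ℝ) :
    union (h ++ [e]) = union h + e.2 := by
  simp [union, matchings]

/-- One round of the multiplicative weight update. -/
lemma potential_append_le [Nontrivial V] (hπ : ∀ i, 0 < π i) (h : History V) (L : Finset V)
    {D : Matrix V V ℝ} (hD : ∀ i j, 0 ≤ D i j) (hout : ∀ i, ∑ j, D i j ≤ π i)
    (hin : ∀ i, ∑ j, D j i ≤ π i) :
    potential π (h ++ [(L, D)])
      ≤ potential π h * (1 - 7 / 144 * (feedback π D * density π h).trace) := by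
  have hstep := trace_exp_sub_le (smul_feedback_isSymm (-(1 / 16)) π (union h))
    (smul_feedback_isSymm (1 / 16) π D) (β := 1 / 8) (by norm_num)
    (fun x => by
      rw [smul_mulVec, dotProduct_smul, smul_eq_mul]
      exact mul_nonneg (by norm_num) (dotProduct_feedback_mulVec_nonneg π hD x))
    (fun x => by
      rw [smul_mulVec, dotProduct_smul, smul_eq_mul]
      linarith [dotProduct_feedback_mulVec_le hπ hD hout hin x])
  have hnew : -(1 / 16 : ℝ) • feedback π (union h) - (1 / 16 : ℝ) • feedback π D
      = -(1 / 16 : ℝ) • feedback π (union (h ++ [(L, D)])) := by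
    rw [union_append, feedback, feedback, feedback, symLaplacian_add, Matrix.mul_add,
      Matrix.add_mul, smul_add, neg_smul, neg_smul, sub_eq_add_neg]
  rw [hnew, ← expFeedback_eq, ← expFeedback_eq, Matrix.mul_smul, trace_smul,
    trace_feedback_mul_density hπ, smul_eq_mul] at hstep
  simp only [potential] at hstep ⊢
  linarith

/-! ### The embedding -/

lemma dotProduct_embeddingGram_mulVec (π : V → ℝ) (h : History V) (x : V → ℝ) :
    x ⬝ᵥ embeddingGram π h *ᵥ x = (embedding π h *ᵥ x) ⬝ᵥ (embedding π h *ᵥ x) := by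
  rw [← embedding_spec, ← mulVec_mulVec, dotProduct_mulVec, ← mulVec_transpose, transpose_transpose]

/-- The first-order loss is the energy of the embedding on the edges of the graph. -/
lemma trace_feedback_mul_density_eq (π : V → ℝ) (h : History V) (D : Matrix V V ℝ) :
    (feedback π D * density π h).trace
      = 1 / 2 * ∑ i, ∑ j, D i j * ∑ k, (embedding π h k i - embedding π h k j) ^ 2 := by
  set B := embedding π h with hB
  have h1 : (feedback π D * density π h).trace = (B * symLaplacian D * Bᵀ).trace := by
    have hY : invSqrtWeight π * density π h * invSqrtWeight π = Bᵀ * B := (embedding_spec π h).symm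
    rw [trace_mul_comm (B * symLaplacian D), ← Matrix.mul_assoc, ← hY,
      trace_mul_comm _ (symLaplacian D), feedback, Matrix.mul_assoc, Matrix.mul_assoc, trace_mul_comm]
    simp only [Matrix.mul_assoc]
  have h2 : ∀ k, (B * symLaplacian D * Bᵀ) k k = B k ⬝ᵥ symLaplacian D *ᵥ B k := by
    intro k
    rw [Matrix.mul_assoc, mul_apply, dotProduct]
    refine Finset.sum_congr rfl fun i _ => ?_
    rw [mul_apply, mulVec, dotProduct]
    rfl
  rw [h1, trace]
  simp only [diag_apply, h2, dotProduct_symLaplacian_mulVec]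
  rw [← Finset.mul_sum, Finset.sum_comm]
  congr 1
  refine Finset.sum_congr rfl fun i _ => ?_
  rw [Finset.sum_comm]
  refine Finset.sum_congr rfl fun j _ => ?_
  rw [Finset.mul_sum]

lemma sum_weight_mul_sum_embedding_sq [Nontrivial V] (hπ : ∀ i, 0 < π i) (h : History V) :
    ∑ i, π i * ∑ k, embedding π h k i ^ 2 = 1 := by
  have h1 : (density π h).trace = 1 := by
    rw [density, trace_smul, trace_proj_mul_expFeedback_mul_proj hπ, smul_eq_mul,
      inv_mul_cancel₀ (potential_pos hπ h).ne']
  rw [← h1, trace]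
  refine Finset.sum_congr rfl fun i _ => ?_
  have h2 : ∑ k, embedding π h k i ^ 2 = embeddingGram π h i i := by
    rw [← embedding_spec, mul_apply]
    exact Finset.sum_congr rfl fun k _ => by rw [transpose_apply]; ring
  have h3 := (Real.sqrt_pos.2 (hπ i)).ne'
  rw [h2, embeddingGram, invSqrtWeight, mul_diagonal, diagonal_mul, diag_apply]
  nth_rw 1 [← Real.mul_self_sqrt (hπ i).le]
  field_simp

lemma sum_weight_mul_embedding [Nontrivial V] (hπ : ∀ i, 0 < π i) (h : History V) (k : V) :
    ∑ i, π i * embedding π h k i = 0 := by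
  have h1 : invSqrtWeight π *ᵥ π = fun i => √(π i) := by
    ext i
    rw [invSqrtWeight_mulVec]
    nth_rw 2 [← Real.mul_self_sqrt (hπ i).le]
    rw [inv_mul_cancel_left₀ (Real.sqrt_pos.2 (hπ i)).ne']
  have h2 : embeddingGram π h *ᵥ π = 0 := by
    rw [embeddingGram, ← mulVec_mulVec, h1, density, ← mulVec_mulVec, smul_mulVec,
      ← mulVec_mulVec, proj_mulVec_sqrt hπ]
    simp
  have h3 := dotProduct_embeddingGram_mulVec π h π
  rw [h2, dotProduct_zero] at h3
  have h4 := congr_fun (dotProduct_self_eq_zero.1 h3.symm) k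
  rw [mulVec, dotProduct] at h4
  simpa [mul_comm] using h4

/-- Distinct vertices have distinct vectors: `P E P` is positive definite on the complement of
`Π^{1/2} 1`, and that vector has no entries of opposite signs. -/
lemma exists_embedding_ne [Nontrivial V] (hπ : ∀ i, 0 < π i) (h : History V) {i j : V}
    (hij : i ≠ j) : ∃ k, embedding π h k i - embedding π h k j ≠ 0 := by
  by_contra! hk
  set x : V → ℝ := Pi.single i 1 - Pi.single j 1 with hx
  have h1 : embedding π h *ᵥ x = 0 := by
    ext k
    rw [hx, mulVec_sub, Pi.sub_apply, mulVec_single_one, mulVec_single_one, col_apply, col_apply,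
      hk k, Pi.zero_apply]
  have h2 := dotProduct_embeddingGram_mulVec π h x
  rw [h1, dotProduct_zero, embeddingGram, dotProduct_invSqrtWeight_conj] at h2
  set z := invSqrtWeight π *ᵥ x with hz
  have h3 : (proj π *ᵥ z) ⬝ᵥ expFeedback π h *ᵥ (proj π *ᵥ z) = 0 := by
    rw [density, smul_mulVec, dotProduct_smul, smul_eq_mul, ← mulVec_mulVec, ← mulVec_mulVec,
      dotProduct_mulVec, ← mulVec_transpose, (proj_isSymm π).eq,
      trace_proj_mul_expFeedback_mul_proj hπ] at h2
    exact (mul_eq_zero.1 h2).resolve_left (inv_ne_zero (potential_pos hπ h).ne')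
  have h4 : proj π *ᵥ z = 0 := by
    rw [expFeedback_eq] at h3
    exact eq_zero_of_dotProduct_exp_mulVec_eq_zero (smul_feedback_isSymm _ _ _) h3
  rw [proj_mulVec, sub_eq_zero] at h4
  set c := (weight π Finset.univ)⁻¹ * ((fun i => √(π i)) ⬝ᵥ z)
  have hi := congr_fun h4 i
  have hj := congr_fun h4 j
  rw [hz, invSqrtWeight_mulVec, Pi.smul_apply, smul_eq_mul] at hi hj
  have hxi : x i = 1 := by simp [hx, hij]
  have hxj : x j = -1 := by simp [hx, hij.symm]
  have hsi := Real.sqrt_pos.2 (hπ i)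
  have hsj := Real.sqrt_pos.2 (hπ j)
  have hc1 : 0 < c := by
    by_contra! hc
    have : 0 < (√(π i))⁻¹ * x i := by rw [hxi, mul_one]; exact inv_pos.2 hsi
    nlinarith [mul_nonneg (neg_nonneg.2 hc) hsi.le]
  have : (√(π j))⁻¹ * x j < 0 := by
    rw [hxj, mul_neg, mul_one]
    exact neg_lt_zero.2 (inv_pos.2 hsj)
  nlinarith [mul_pos hc1 hsj]

/-! ### Gaussian projections -/

instance : IsProbabilityMeasure (gaussian V) := by unfold gaussian; infer_instance

lemma measurable_dotProduct_right (v : V → ℝ) : Measurable fun u : V → ℝ => u ⬝ᵥ v := by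
  simp only [dotProduct]
  fun_prop

lemma gaussian_map_dotProduct (v : V → ℝ) :
    (gaussian V).map (fun u => u ⬝ᵥ v) = gaussianReal 0 (v ⬝ᵥ v).toNNReal := by
  have hm := measurable_dotProduct_right v
  apply Measure.ext_of_charFun
  ext t
  rw [charFun_apply_real, integral_map hm.aemeasurable (by fun_prop), charFun_gaussianReal,
    gaussian]
  have h1 : ∀ u : V → ℝ, Complex.exp (t * ((u ⬝ᵥ v : ℝ) : ℂ) * Complex.I)
      = ∏ i, Complex.exp (((t * v i : ℝ) : ℂ) * (u i : ℂ) * Complex.I) := by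
    intro u
    rw [← Complex.exp_sum, dotProduct]
    push_cast
    rw [Finset.mul_sum, Finset.sum_mul]
    congr 1
    exact Finset.sum_congr rfl fun i _ => by ring
  simp_rw [h1]
  rw [integral_fintype_prod_eq_prod (μ := fun _ => gaussianReal 0 1)
    (f := fun i (x : ℝ) => Complex.exp (((t * v i : ℝ) : ℂ) * (x : ℂ) * Complex.I))]
  simp_rw [← charFun_apply_real, charFun_gaussianReal]
  rw [← Complex.exp_sum]
  congr 1
  have h2 : 0 ≤ v ⬝ᵥ v := Finset.sum_nonneg fun _ _ => mul_self_nonneg _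
  have h3 : (((v ⬝ᵥ v).toNNReal : ℝ) : ℂ) = ∑ i, ((v i : ℂ) * v i) := by
    rw [Real.coe_toNNReal _ h2, dotProduct]
    push_cast
    rfl
  rw [h3, Finset.sum_mul, Finset.sum_div]
  simp only [Complex.ofReal_zero, mul_zero, zero_mul, zero_sub, NNReal.coe_one, Complex.ofReal_one,
    one_mul]
  rw [← Finset.sum_neg_distrib]
  refine Finset.sum_congr rfl fun i _ => ?_
  push_cast
  ring

lemma gaussian_dotProduct_eq_zero {v : V → ℝ} (hv : v ≠ 0) :
    gaussian V {u | u ⬝ᵥ v = 0} = 0 := by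
  have hpos : (v ⬝ᵥ v).toNNReal ≠ 0 := by
    have h : 0 ≤ v ⬝ᵥ v := Finset.sum_nonneg fun _ _ => mul_self_nonneg _
    have h0 : v ⬝ᵥ v ≠ 0 := fun h => hv (dotProduct_self_eq_zero.1 h)
    exact (Real.toNNReal_pos.2 (lt_of_le_of_ne h h0.symm)).ne'
  have := nullSingletonClass_gaussianReal (μ := 0) hpos
  have h1 : (gaussian V).map (fun u => u ⬝ᵥ v) {0} = 0 := by
    rw [gaussian_map_dotProduct]
    exact measure_singleton 0
  rwa [Measure.map_apply (measurable_dotProduct_right v) (measurableSet_singleton 0)] at h1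

lemma integrable_dotProduct_sq (v : V → ℝ) :
    Integrable (fun u => (u ⬝ᵥ v) ^ 2) (gaussian V) := by
  have h := (memLp_id_gaussianReal' (μ := 0) (v := (v ⬝ᵥ v).toNNReal) 2 (by simp)).integrable_sq
  rw [← gaussian_map_dotProduct] at h
  exact h.comp_measurable (measurable_dotProduct_right v)

lemma integral_dotProduct_sq (v : V → ℝ) : ∫ u, (u ⬝ᵥ v) ^ 2 ∂gaussian V = v ⬝ᵥ v := by
  have h : ∫ x, x ^ 2 ∂gaussianReal 0 (v ⬝ᵥ v).toNNReal = v ⬝ᵥ v := by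
    have := variance_fun_id_gaussianReal (μ := 0) (v := (v ⬝ᵥ v).toNNReal)
    rw [variance_eq_integral (by fun_prop), integral_id_gaussianReal] at this
    rw [Real.coe_toNNReal (v ⬝ᵥ v) (Finset.sum_nonneg fun i _ => mul_self_nonneg (v i))] at this
    simpa only [sub_zero] using this
  rwa [← gaussian_map_dotProduct, integral_map (measurable_dotProduct_right v).aemeasurable
    (by fun_prop)] at h

lemma integral_exp_sq_div_four : ∫ x, Real.exp (x ^ 2 / 4) ∂gaussianReal 0 1 = √2 := by
  rw [integral_gaussianReal_eq_integral_smul one_ne_zero]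
  have h : ∀ x : ℝ, gaussianPDFReal 0 1 x • Real.exp (x ^ 2 / 4)
      = (√(2 * Real.pi))⁻¹ * Real.exp (-(1 / 4) * x ^ 2) := by
    intro x
    rw [gaussianPDFReal, smul_eq_mul, mul_assoc, ← Real.exp_add]
    simp only [NNReal.coe_one, mul_one, sub_zero]
    congr 2
    ring
  simp_rw [h]
  rw [integral_const_mul, integral_gaussian, inv_mul_eq_div, ← Real.sqrt_div (by positivity)]
  congr 1
  field_simp
  norm_num

lemma integral_exp_dotProduct_sq {v : V → ℝ} (hv : v ⬝ᵥ v = 1) :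
    Integrable (fun u => Real.exp ((u ⬝ᵥ v) ^ 2 / 4)) (gaussian V) ∧
      ∫ u, Real.exp ((u ⬝ᵥ v) ^ 2 / 4) ∂gaussian V = √2 := by
  have h := integral_exp_sq_div_four
  have h1 : gaussianReal 0 1 = (gaussian V).map fun u => u ⬝ᵥ v := by
    rw [gaussian_map_dotProduct, hv, Real.toNNReal_one]
  rw [h1, integral_map (measurable_dotProduct_right v).aemeasurable (by fun_prop)] at h
  exact ⟨.of_integral_ne_zero (by rw [h]; positivity), h⟩

/-- The part of the second moment of `⟨u, v⟩` on the event that `⟨u, w⟩²` exceeds its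
expectation by a factor `K`. -/
lemma integral_indicator_dotProduct_sq_le (v w : V → ℝ) (K : ℝ) :
    ∫ u, {u : V → ℝ | K * (w ⬝ᵥ w) < (u ⬝ᵥ w) ^ 2}.indicator (fun u => (u ⬝ᵥ v) ^ 2) u ∂gaussian V
      ≤ v ⬝ᵥ v * (12 * Real.exp (-K / 8)) := by
  have hnn : ∀ x : V → ℝ, 0 ≤ x ⬝ᵥ x := fun x => Finset.sum_nonneg fun _ _ => mul_self_nonneg _
  by_cases hv : v = 0
  · simp [hv]
  by_cases hw : w = 0
  · simp only [hw, dotProduct_zero, mul_zero, ne_eq, OfNat.ofNat_ne_zero, not_false_eq_true,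
      zero_pow, lt_self_iff_false, Set.ofPred_false, Set.indicator_empty, integral_zero]
    exact mul_nonneg (hnn v) (by positivity)
  have hunit : ∀ x : V → ℝ, x ≠ 0 → ∃ (r : ℝ) (y : V → ℝ), 0 < r ^ 2 ∧ y ⬝ᵥ y = 1 ∧ x = r • y := by
    intro x hx
    have hx0 : x ⬝ᵥ x ≠ 0 := fun h => hx (dotProduct_self_eq_zero.1 h)
    have hr := Real.sqrt_pos.2 (lt_of_le_of_ne (hnn x) hx0.symm)
    refine ⟨√(x ⬝ᵥ x), (√(x ⬝ᵥ x))⁻¹ • x, by positivity, ?_, ?_⟩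
    · rw [smul_dotProduct, dotProduct_smul, smul_eq_mul, smul_eq_mul]
      nth_rw 3 [← Real.mul_self_sqrt (hnn x)]
      field_simp
    · rw [smul_smul, mul_inv_cancel₀ hr.ne', one_smul]
  obtain ⟨r, y, hr, hy, rfl⟩ := hunit v hv
  obtain ⟨s, z, hs, hz, rfl⟩ := hunit w hw
  obtain ⟨hyi, hyv⟩ := integral_exp_dotProduct_sq hy
  obtain ⟨hzi, hzv⟩ := integral_exp_dotProduct_sq hz
  have hpt : ∀ u : V → ℝ, {u : V → ℝ | K * ((s • z) ⬝ᵥ (s • z)) < (u ⬝ᵥ (s • z)) ^ 2}.indicator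
      (fun u => (u ⬝ᵥ (r • y)) ^ 2) u
      ≤ r ^ 2 * (4 * Real.exp (-K / 8)) *
        (Real.exp ((u ⬝ᵥ y) ^ 2 / 4) + Real.exp ((u ⬝ᵥ z) ^ 2 / 4)) := by
    intro u
    refine Set.indicator_apply_le' (fun hu => ?_) fun _ => by positivity
    simp only [Set.mem_ofPred_eq, dotProduct_smul, smul_dotProduct, smul_eq_mul, hz] at hu ⊢
    have hK : K < (u ⬝ᵥ z) ^ 2 := by
      refine lt_of_mul_lt_mul_left ?_ hs.le
      nlinarith
    -- Both the square and the indicator are bounded by exponentials with finite expectation.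
    have h1 : (u ⬝ᵥ y) ^ 2 ≤ 8 * Real.exp ((u ⬝ᵥ y) ^ 2 / 8) := by
      linarith [Real.add_one_le_exp ((u ⬝ᵥ y) ^ 2 / 8)]
    have h2 : 1 ≤ Real.exp (-K / 8) * Real.exp ((u ⬝ᵥ z) ^ 2 / 8) := by
      rw [← Real.exp_add]
      exact Real.one_le_exp (by linarith)
    have hsq : ∀ t : ℝ, Real.exp (t / 4) = Real.exp (t / 8) ^ 2 := fun t => by
      rw [← Real.exp_nat_mul]
      congr 1
      push_cast
      ring
    rw [hsq, hsq]
    set a := Real.exp ((u ⬝ᵥ y) ^ 2 / 8)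
    set b := Real.exp ((u ⬝ᵥ z) ^ 2 / 8)
    set k := Real.exp (-K / 8)
    have ha : 0 < a := Real.exp_pos _
    have hk : 0 < k := Real.exp_pos _
    have h3 : (u ⬝ᵥ y) ^ 2 ≤ 4 * k * (a ^ 2 + b ^ 2) := by
      nlinarith [mul_nonneg ha.le (sub_nonneg.2 h2), mul_nonneg hk.le (sq_nonneg (a - b))]
    nlinarith [mul_le_mul_of_nonneg_left h3 hr.le]
  calc _ ≤ ∫ u, r ^ 2 * (4 * Real.exp (-K / 8)) *
        (Real.exp ((u ⬝ᵥ y) ^ 2 / 4) + Real.exp ((u ⬝ᵥ z) ^ 2 / 4)) ∂gaussian V :=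
      integral_mono_of_nonneg
        (.of_forall fun u => Set.indicator_nonneg (fun _ _ => sq_nonneg _) _)
        ((hyi.add hzi).const_mul _) (.of_forall hpt)
    _ = r ^ 2 * (4 * Real.exp (-K / 8)) * (√2 + √2) := by
      rw [integral_const_mul, integral_add hyi hzi, hyv, hzv]
    _ ≤ _ := by
      have h2 : √2 ≤ 3 / 2 := Real.sqrt_le_iff.2 ⟨by norm_num, by norm_num⟩
      simp only [dotProduct_smul, smul_dotProduct, smul_eq_mul, hy]
      have : 0 ≤ r ^ 2 * (4 * Real.exp (-K / 8)) := by positivity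
      nlinarith [mul_le_mul_of_nonneg_left (add_le_add h2 h2) this]

/-! ### The cut at the weighted median -/

lemma weight_add_weight_compl (π : V → ℝ) (S : Finset V) :
    weight π S + weight π Sᶜ = weight π Finset.univ :=
  Finset.sum_add_sum_compl S π

lemma weight_mono (hπ : ∀ i, 0 < π i) {S T : Finset V} (h : S ⊆ T) : weight π S ≤ weight π T :=
  Finset.sum_le_sum_of_subset_of_nonneg h fun i _ _ => (hπ i).le

/-- For distinct numbers, the lower part of the cut at the median has at least half of the
weight, but not without the median itself. -/
lemma weight_medianCut [Nonempty V] (hπ : ∀ i, 0 < π i) {x : V → ℝ} (hx : Function.Injective x) :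
    weight π Finset.univ / 2 ≤ weight π (medianCut π x) ∧
      ∃ k, weight π (medianCut π x) - π k < weight π Finset.univ / 2 := by
  have hW := weight_univ_pos hπ
  set K : Set V := {k | weight π Finset.univ / 2 ≤ weight π {j | x j ≤ x k}} with hK
  obtain ⟨m, -, hm⟩ := Finset.exists_max_image Finset.univ x Finset.univ_nonempty
  have hmK : m ∈ K := by
    have : (Finset.univ.filter fun j => x j ≤ x m) = Finset.univ :=
      Finset.filter_true_of_mem fun j hj => hm j hj
    rw [hK, Set.mem_ofPred_eq, this]
    linarith
  have hfin : (x '' K).Finite := Set.toFinite _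
  have hne : (x '' K).Nonempty := ⟨x m, m, hmK, rfl⟩
  obtain ⟨k, hkK, hk⟩ := hne.csInf_mem hfin
  have hmed : weightedMedian π x = x k := hk.symm
  have hL : medianCut π x = Finset.univ.filter fun j => x j ≤ x k := by
    rw [medianCut, hmed]
  refine ⟨hL ▸ hkK, k, ?_⟩
  have hkL : k ∈ medianCut π x := by rw [mem_medianCut, hmed]
  have herase : weight π (medianCut π x) - π k = weight π ((medianCut π x).erase k) := by
    rw [weight, weight, ← Finset.sum_erase_add _ _ hkL, add_sub_cancel_right]
  rw [herase]
  by_contra! hcon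
  have hne : ((medianCut π x).erase k).Nonempty := by
    rw [Finset.nonempty_iff_ne_empty]
    intro h0
    have : weight π ∅ = 0 := Finset.sum_empty
    rw [h0, this] at hcon
    linarith
  -- The largest number below the median would itself be a candidate for the median.
  obtain ⟨l, hl, hlmax⟩ := Finset.exists_max_image _ x hne
  have hlK : l ∈ K := hcon.trans <| weight_mono hπ fun j hj => by
    simpa using hlmax j hj
  have h1 : weightedMedian π x ≤ x l := csInf_le hfin.bddBelow ⟨l, hlK, rfl⟩
  rw [Finset.mem_erase, mem_medianCut] at hl
  exact hl.1 (hx (le_antisymm (hmed ▸ hl.2) (hmed ▸ h1)))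

/-- The weights of the two sides of a cut are within a factor three of each other, and the first
side is the heavier one. -/
structure IsBalancedCut (π : V → ℝ) (L : Finset V) : Prop where
  half_le : weight π Finset.univ / 2 ≤ weight π L
  quarter_le : weight π Finset.univ / 4 ≤ weight π Lᶜ

lemma isBalancedCut_medianCut [Nonempty V] (hπ : ∀ i, 0 < π i)
    (hlight : ∀ i, π i < weight π Finset.univ / 4) {x : V → ℝ} (hx : Function.Injective x) :
    IsBalancedCut π (medianCut π x) := by
  obtain ⟨h1, k, hk⟩ := weight_medianCut hπ hx
  refine ⟨h1, ?_⟩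
  linarith [hlight k, weight_add_weight_compl π (medianCut π x)]

lemma IsBalancedCut.nonempty [Nonempty V] (hπ : ∀ i, 0 < π i) {L : Finset V}
    (hL : IsBalancedCut π L) : L.Nonempty ∧ Lᶜ.Nonempty := by
  have hW := weight_univ_pos hπ
  have h0 : ∀ S : Finset V, 0 < weight π S → S.Nonempty := fun S hS =>
    Finset.nonempty_of_sum_ne_zero hS.ne'
  exact ⟨h0 _ (by linarith [hL.half_le]), h0 _ (by linarith [hL.quarter_le])⟩

lemma IsDirectedMatching.balanced {L : Finset V} {D : Matrix V V ℝ}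
    (hD : IsDirectedMatching π L D) (i : V) : ∑ j, D i j = ∑ j, D j i := by
  by_cases hi : i ∈ L
  · rw [hD.out_left i hi, hD.in_left i hi]
  · rw [hD.out_right i (Finset.mem_compl.2 hi), hD.in_right i (Finset.mem_compl.2 hi)]

lemma IsDirectedMatching.degree_bounds [Nonempty V] (hπ : ∀ i, 0 < π i) {L : Finset V}
    (hL : IsBalancedCut π L) {D : Matrix V V ℝ} (hD : IsDirectedMatching π L D) (i : V) :
    π i / 3 ≤ ∑ j, D i j ∧ ∑ j, D i j ≤ π i := by
  have hW := weight_univ_pos hπ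
  have hsum := weight_add_weight_compl π L
  have h1 := hL.half_le
  have h2 := hL.quarter_le
  have hpos : 0 < weight π L := by linarith
  have hi := hπ i
  by_cases hiL : i ∈ L
  · rw [hD.out_left i hiL, le_div_iff₀ hpos, div_le_iff₀ hpos]
    constructor
    · nlinarith
    · nlinarith
  · rw [(hD.out_right i (Finset.mem_compl.2 hiL))]
    constructor <;> linarith

/-! ### Energy of a matching across the median cut -/

/-- Edges across the cut at `y` are at least as long as the distances of their ends to `y`, and
the weighted second moment around `y` is at least that around the mean. -/
lemma sum_sq_le_energy {L : Finset V} {D : Matrix V V ℝ} (hD : IsDirectedMatching π L D)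
    (hπ : ∀ i, 0 < π i) (hdeg : ∀ i, π i / 3 ≤ ∑ j, D i j) {x : V → ℝ} {y : ℝ}
    (hy : ∀ i, i ∈ L ↔ x i ≤ y) (hx : ∑ i, π i * x i = 0) :
    1 / 3 * ∑ i, π i * x i ^ 2 ≤ 1 / 2 * ∑ i, ∑ j, D i j * (x i - x j) ^ 2 := by
  have h1 : ∑ i, ∑ j, D i j * ((x i - y) ^ 2 + (x j - y) ^ 2)
      ≤ ∑ i, ∑ j, D i j * (x i - x j) ^ 2 := by
    refine Finset.sum_le_sum fun i _ => Finset.sum_le_sum fun j _ => ?_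
    by_cases h0 : D i j = 0
    · simp [h0]
    refine mul_le_mul_of_nonneg_left ?_ (hD.nonneg i j)
    have hc := hD.crossing i j h0
    rw [hy, hy, not_le] at hc
    rcases le_or_gt (x i) y with hi | hi
    · nlinarith [mul_nonneg (sub_nonneg.2 hi) (sub_nonneg.2 (hc.1 hi).le)]
    · have hj : x j ≤ y := not_lt.1 fun h => absurd (hc.2 h) (not_le.2 hi)
      nlinarith [mul_nonneg (sub_nonneg.2 hi.le) (sub_nonneg.2 hj)]
  rw [sum_sum_mul_add_eq D fun i => (x i - y) ^ 2] at h1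
  have h2 : ∑ i, 2 / 3 * (π i * (x i - y) ^ 2)
      ≤ ∑ i, (∑ j, D i j + ∑ j, D j i) * (x i - y) ^ 2 := by
    refine Finset.sum_le_sum fun i _ => ?_
    rw [← hD.balanced i]
    nlinarith [mul_le_mul_of_nonneg_right (hdeg i) (sq_nonneg (x i - y))]
  have h3 : ∑ i, π i * (x i - y) ^ 2
      = ∑ i, π i * x i ^ 2 - 2 * y * ∑ i, π i * x i + ∑ i, π i * y ^ 2 := by
    rw [Finset.mul_sum, ← Finset.sum_sub_distrib, ← Finset.sum_add_distrib]
    exact Finset.sum_congr rfl fun i _ => by ring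
  have h4 : 0 ≤ ∑ i, π i * y ^ 2 := Finset.sum_nonneg fun i _ =>
    mul_nonneg (hπ i).le (sq_nonneg y)
  rw [← Finset.mul_sum, h3, hx] at h2
  linarith

/-- The set of the directions `u` along which the projection of `w` is longer than expected by a
factor `√K`. -/
def stretched (K : ℝ) (w : V → ℝ) : Set (V → ℝ) := {u | K * (w ⬝ᵥ w) < (u ⬝ᵥ w) ^ 2}

/-- The weighted second moment of the projected points, made nonpositive wherever the
projection stretches one of the differences of the vectors. -/
noncomputable def truncatedMoment (π : V → ℝ) (B : Matrix V V ℝ) (K : ℝ) (u : V → ℝ) : ℝ :=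
  ∑ i, π i * ((u ⬝ᵥ B.col i) ^ 2 - ∑ j, ∑ k,
    (stretched K (B.col j - B.col k)).indicator (fun u => (u ⬝ᵥ B.col i) ^ 2) u)

lemma truncatedMoment_le_moment (hπ : ∀ i, 0 < π i) (B : Matrix V V ℝ) (K : ℝ) (u : V → ℝ) :
    truncatedMoment π B K u ≤ ∑ i, π i * (u ⬝ᵥ B.col i) ^ 2 := by
  refine Finset.sum_le_sum fun i _ => mul_le_mul_of_nonneg_left (sub_le_self _ ?_) (hπ i).le
  exact Finset.sum_nonneg fun j _ => Finset.sum_nonneg fun k _ =>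
    Set.indicator_nonneg (fun _ _ => sq_nonneg _) _

lemma truncatedMoment_nonpos_of_mem (hπ : ∀ i, 0 < π i) (B : Matrix V V ℝ) (K : ℝ) {u : V → ℝ}
    {j k : V} (hu : u ∈ stretched K (B.col j - B.col k)) : truncatedMoment π B K u ≤ 0 := by
  refine Finset.sum_nonpos fun i _ => mul_nonpos_of_nonneg_of_nonpos (hπ i).le ?_
  rw [sub_nonpos]
  have h0 : ∀ j k, 0 ≤ (stretched K (B.col j - B.col k)).indicator
      (fun u => (u ⬝ᵥ B.col i) ^ 2) u := fun j k => Set.indicator_nonneg (fun _ _ => sq_nonneg _) _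
  calc (u ⬝ᵥ B.col i) ^ 2 = (stretched K (B.col j - B.col k)).indicator
        (fun u => (u ⬝ᵥ B.col i) ^ 2) u := by rw [Set.indicator_of_mem hu]
    _ ≤ ∑ k, (stretched K (B.col j - B.col k)).indicator (fun u => (u ⬝ᵥ B.col i) ^ 2) u :=
      Finset.single_le_sum (f := fun k => (stretched K (B.col j - B.col k)).indicator
        (fun u => (u ⬝ᵥ B.col i) ^ 2) u) (fun k _ => h0 j k) (Finset.mem_univ k)
    _ ≤ _ := Finset.single_le_sum (f := fun j => ∑ k, (stretched K (B.col j - B.col k)).indicator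
        (fun u => (u ⬝ᵥ B.col i) ^ 2) u) (fun j _ => Finset.sum_nonneg fun k _ => h0 j k)
        (Finset.mem_univ j)

/-- Whatever the matching player answers, the loss is bounded below by a function of the
direction of projection alone. -/
lemma truncatedMoment_le_loss [Nontrivial V] (hπ : ∀ i, 0 < π i) (h : History V) {K : ℝ}
    (hK : 0 < K) {u : V → ℝ} {D : Matrix V V ℝ}
    (hL : IsBalancedCut π (medianCut π (u ᵥ* embedding π h)))
    (hD : IsDirectedMatching π (medianCut π (u ᵥ* embedding π h)) D) :
    truncatedMoment π (embedding π h) K u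
      ≤ 3 * K * (feedback π D * density π h).trace := by
  have hloss := trace_feedback_mul_density_eq π h D
  set B := embedding π h with hB
  have hcol : ∀ i j, ∑ k, (B k i - B k j) ^ 2 = (B.col i - B.col j) ⬝ᵥ (B.col i - B.col j) :=
    fun i j => Finset.sum_congr rfl fun k _ => by simp only [Pi.sub_apply, col_apply]; ring
  simp only [hcol] at hloss
  have hnn : ∀ w : V → ℝ, 0 ≤ w ⬝ᵥ w := fun w => Finset.sum_nonneg fun _ _ => mul_self_nonneg _
  by_cases hbad : ∃ j k, u ∈ stretched K (B.col j - B.col k)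
  · obtain ⟨j, k, hjk⟩ := hbad
    refine (truncatedMoment_nonpos_of_mem hπ B K hjk).trans ?_
    rw [hloss]
    have : 0 ≤ ∑ i, ∑ j, D i j * ((B.col i - B.col j) ⬝ᵥ (B.col i - B.col j)) :=
      Finset.sum_nonneg fun i _ => Finset.sum_nonneg fun j _ => mul_nonneg (hD.nonneg i j) (hnn _)
    positivity
  · push Not at hbad
    have hx : ∑ i, π i * (u ᵥ* B) i = 0 := by
      simp only [vecMul, dotProduct, Finset.mul_sum]
      rw [Finset.sum_comm]
      refine Finset.sum_eq_zero fun k _ => ?_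
      rw [← mul_zero (u k), ← sum_weight_mul_embedding hπ h k, Finset.mul_sum]
      exact Finset.sum_congr rfl fun i _ => by ring
    have h1 := sum_sq_le_energy hD hπ (fun i => (hD.degree_bounds hπ hL i).1)
      (mem_medianCut π _) hx
    have h2 : ∑ i, ∑ j, D i j * ((u ᵥ* B) i - (u ᵥ* B) j) ^ 2
        ≤ K * ∑ i, ∑ j, D i j * ((B.col i - B.col j) ⬝ᵥ (B.col i - B.col j)) := by
      rw [Finset.mul_sum]
      refine Finset.sum_le_sum fun i _ => ?_
      rw [Finset.mul_sum]
      refine Finset.sum_le_sum fun j _ => ?_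
      have h3 : (u ⬝ᵥ (B.col i - B.col j)) ^ 2
          ≤ K * ((B.col i - B.col j) ⬝ᵥ (B.col i - B.col j)) := not_lt.1 (hbad i j)
      rw [dotProduct_sub] at h3
      calc D i j * ((u ᵥ* B) i - (u ᵥ* B) j) ^ 2
          ≤ D i j * (K * ((B.col i - B.col j) ⬝ᵥ (B.col i - B.col j))) :=
            mul_le_mul_of_nonneg_left h3 (hD.nonneg i j)
        _ = _ := by ring
    have h4 := truncatedMoment_le_moment hπ B K u
    have h5 : ∑ i, π i * (u ⬝ᵥ B.col i) ^ 2 = ∑ i, π i * (u ᵥ* B) i ^ 2 := rfl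
    rw [hloss]
    linarith

lemma measurableSet_stretched (K : ℝ) (w : V → ℝ) : MeasurableSet (stretched K w) :=
  measurableSet_lt measurable_const ((measurable_dotProduct_right w).pow_const 2)

lemma integrable_truncatedMoment (π : V → ℝ) (B : Matrix V V ℝ) (K : ℝ) :
    Integrable (truncatedMoment π B K) (gaussian V) := by
  refine integrable_finsetSum _ fun i _ => ((integrable_dotProduct_sq _).sub ?_).const_mul _
  exact integrable_finsetSum _ fun j _ => integrable_finsetSum _ fun k _ =>
    (integrable_dotProduct_sq _).indicator (measurableSet_stretched _ _)

lemma le_integral_truncatedMoment (hπ : ∀ i, 0 < π i) {B : Matrix V V ℝ}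
    (hB : ∑ i, π i * ∑ k, B k i ^ 2 = 1) (K : ℝ) :
    1 - (Fintype.card V : ℝ) ^ 2 * (12 * Real.exp (-K / 8))
      ≤ ∫ u, truncatedMoment π B K u ∂gaussian V := by
  have hI : ∀ i j k : V, Integrable ((stretched K (B.col j - B.col k)).indicator
      fun u => (u ⬝ᵥ B.col i) ^ 2) (gaussian V) := fun i j k =>
    (integrable_dotProduct_sq _).indicator (measurableSet_stretched _ _)
  have hI2 : ∀ i, Integrable (fun u => ∑ j, ∑ k, (stretched K (B.col j - B.col k)).indicator
      (fun u => (u ⬝ᵥ B.col i) ^ 2) u) (gaussian V) := fun i =>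
    integrable_finsetSum _ fun j _ => integrable_finsetSum _ fun k _ => hI i j k
  have hterm : ∀ i, B.col i ⬝ᵥ B.col i * (1 - (Fintype.card V : ℝ) ^ 2 * (12 * Real.exp (-K / 8)))
      ≤ ∫ u, ((u ⬝ᵥ B.col i) ^ 2 - ∑ j, ∑ k, (stretched K (B.col j - B.col k)).indicator
        (fun u => (u ⬝ᵥ B.col i) ^ 2) u) ∂gaussian V := by
    intro i
    rw [integral_sub (integrable_dotProduct_sq _) (hI2 i), integral_dotProduct_sq,
      integral_finsetSum _ fun j _ => integrable_finsetSum _ fun k _ => hI i j k]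
    have : ∑ j : V, ∫ u, ∑ k, (stretched K (B.col j - B.col k)).indicator
        (fun u => (u ⬝ᵥ B.col i) ^ 2) u ∂gaussian V
        ≤ ∑ j : V, ∑ k : V, B.col i ⬝ᵥ B.col i * (12 * Real.exp (-K / 8)) := by
      refine Finset.sum_le_sum fun j _ => ?_
      rw [integral_finsetSum _ fun k _ => hI i j k]
      exact Finset.sum_le_sum fun k _ => integral_indicator_dotProduct_sq_le _ _ K
    simp only [Finset.sum_const, Finset.card_univ, nsmul_eq_mul] at this
    linarith
  have hsum : ∑ i, π i * (B.col i ⬝ᵥ B.col i) = 1 := by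
    rw [← hB]
    refine Finset.sum_congr rfl fun i _ => ?_
    congr 1
    exact Finset.sum_congr rfl fun k _ => by rw [col_apply]; ring
  unfold truncatedMoment
  have hI3 : ∀ i, Integrable (fun u => π i * ((u ⬝ᵥ B.col i) ^ 2 - ∑ j, ∑ k,
      (stretched K (B.col j - B.col k)).indicator (fun u => (u ⬝ᵥ B.col i) ^ 2) u))
      (gaussian V) := fun i => ((integrable_dotProduct_sq _).sub (hI2 i)).const_mul _
  rw [integral_finsetSum _ fun i _ => hI3 i]
  simp only [integral_const_mul]
  calc _ = ∑ i, π i * (B.col i ⬝ᵥ B.col i *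
        (1 - (Fintype.card V : ℝ) ^ 2 * (12 * Real.exp (-K / 8)))) := by
        simp only [← mul_assoc]
        rw [← Finset.sum_mul, hsum, one_mul]
    _ ≤ _ := Finset.sum_le_sum fun i _ => mul_le_mul_of_nonneg_left (hterm i) (hπ i).le

lemma five_le_card [Nonempty V] (hπ : ∀ i, 0 < π i)
    (hlight : ∀ i, π i < weight π Finset.univ / 4) : 5 ≤ Fintype.card V := by
  have h1 : weight π Finset.univ < ∑ _i : V, weight π Finset.univ / 4 :=
    Finset.sum_lt_sum_of_nonempty Finset.univ_nonempty fun i _ => hlight i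
  rw [Finset.sum_const, Finset.card_univ, nsmul_eq_mul] at h1
  have hW := weight_univ_pos hπ
  have h2 : (4 : ℝ) < Fintype.card V := by nlinarith
  exact_mod_cast h2

/-- With `K = 32 log n`, long projections contribute less than half of the second moment. -/
lemma half_le_integral_truncatedMoment [Nontrivial V] (hπ : ∀ i, 0 < π i)
    (hlight : ∀ i, π i < weight π Finset.univ / 4) (h : History V) :
    1 / 2 ≤ ∫ u, truncatedMoment π (embedding π h) (32 * Real.log (Fintype.card V)) u
      ∂gaussian V := by
  refine le_trans ?_ (le_integral_truncatedMoment hπ (sum_weight_mul_sum_embedding_sq hπ h) _)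
  have hn : (5 : ℝ) ≤ Fintype.card V := by exact_mod_cast five_le_card hπ hlight
  set n : ℝ := (Fintype.card V : ℝ)
  have h1 : Real.exp (-(32 * Real.log n) / 8) = (n ^ 4)⁻¹ := by
    rw [show -(32 * Real.log n) / 8 = -(((4 : ℕ) : ℝ) * Real.log n) by push_cast; ring,
      Real.exp_neg,
      Real.exp_nat_mul, Real.exp_log (by linarith)]
  have h2 : n ^ 2 * (12 * (n ^ 4)⁻¹) = 12 / n ^ 2 := by
    field_simp
  rw [h1, h2]
  have h3 : 12 / n ^ 2 ≤ 1 / 2 := by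
    rw [div_le_div_iff₀ (by positivity) (by norm_num)]
    nlinarith
  linarith

lemma ae_injective_vecMul_embedding [Nontrivial V] (hπ : ∀ i, 0 < π i) (h : History V) :
    ∀ᵐ u ∂gaussian V, Function.Injective (u ᵥ* embedding π h) := by
  have h1 : ∀ i j, i ≠ j → ∀ᵐ u ∂gaussian V, (u ᵥ* embedding π h) i ≠ (u ᵥ* embedding π h) j := by
    intro i j hij
    obtain ⟨k, hk⟩ := exists_embedding_ne hπ h hij
    have hw : (embedding π h).col i - (embedding π h).col j ≠ 0 := fun h0 => hk (congr_fun h0 k)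
    have := gaussian_dotProduct_eq_zero hw
    rw [ae_iff]
    convert this using 4 with u
    rw [dotProduct_sub, not_not, sub_eq_zero]
    rfl
  have h2 : ∀ᵐ u ∂gaussian V, ∀ i j, i ≠ j →
      (u ᵥ* embedding π h) i ≠ (u ᵥ* embedding π h) j := by
    simpa only [ae_all_iff] using h1
  filter_upwards [h2] with u hu i j hij
  by_contra hne
  exact hu i j hne hij

/-! ### From the potential to the expansion -/

lemma outWeight_add (A D : Matrix V V ℝ) (S : Finset V) :
    outWeight (A + D) S = outWeight A S + outWeight D S := by
  simp only [outWeight, Matrix.add_apply, Finset.sum_add_distrib]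

lemma IsEulerian.add {A D : Matrix V V ℝ} (hA : IsEulerian A) (hD : IsEulerian D) :
    IsEulerian (A + D) where
  nonneg i j := add_nonneg (hA.nonneg i j) (hD.nonneg i j)
  balanced i := by
    simp only [Matrix.add_apply, Finset.sum_add_distrib, hA.balanced i, hD.balanced i]

lemma isEulerian_zero : IsEulerian (0 : Matrix V V ℝ) := ⟨fun _ _ => le_rfl, fun _ => by simp⟩

lemma IsDirectedMatching.isEulerian {L : Finset V} {D : Matrix V V ℝ}
    (hD : IsDirectedMatching π L D) : IsEulerian D := ⟨hD.nonneg, hD.balanced⟩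

lemma IsEulerian.outWeight_compl {A : Matrix V V ℝ} (hA : IsEulerian A) (S : Finset V) :
    outWeight A Sᶜ = outWeight A S := by
  have h1 : outWeight A S + ∑ i ∈ S, ∑ j ∈ S, A i j = ∑ i ∈ S, ∑ j, A i j := by
    rw [outWeight, ← Finset.sum_add_distrib]
    exact Finset.sum_congr rfl fun i _ => by rw [add_comm, Finset.sum_add_sum_compl]
  have h2 : outWeight A Sᶜ + ∑ i ∈ S, ∑ j ∈ S, A j i = ∑ i ∈ S, ∑ j, A j i := by
    rw [outWeight, compl_compl, Finset.sum_comm (s := Sᶜ) (f := fun i j => A i j),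
      ← Finset.sum_add_distrib]
    exact Finset.sum_congr rfl fun i _ => by rw [add_comm, Finset.sum_add_sum_compl]
  rw [Finset.sum_congr rfl fun i _ => (hA.balanced i).symm,
    Finset.sum_comm (f := fun i j => A j i)] at h2
  linarith

lemma le_edgeExpansion [Nontrivial V] {A : Matrix V V ℝ} (hπ : ∀ i, 0 < π i) (hA : IsEulerian A)
    {φ : ℝ} (hφ : ∀ S : Finset V, S.Nonempty → Sᶜ.Nonempty →
      φ * min (weight π S) (weight π Sᶜ) ≤ outWeight A S) : φ ≤ edgeExpansion π A := by
  obtain ⟨i, j, hij⟩ := exists_pair_ne V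
  have : Nonempty {S : Finset V // S.Nonempty ∧ Sᶜ.Nonempty} :=
    ⟨{i}, Finset.singleton_nonempty i, j, by simpa using hij.symm⟩
  refine le_ciInf fun ⟨S, hS, hSc⟩ => ?_
  have h0 : ∀ S : Finset V, S.Nonempty → 0 < weight π S := fun S hS =>
    Finset.sum_pos (fun i _ => hπ i) hS
  rw [setExpansion, hA.outWeight_compl, min_self, le_div_iff₀ (lt_min (h0 S hS) (h0 _ hSc))]
  exact hφ S hS hSc

lemma sum_sum_mul_indicator_sub_sq (A : Matrix V V ℝ) (S : Finset V) :
    ∑ i, ∑ j, A i j * ((if i ∈ S then (1 : ℝ) else 0) - if j ∈ S then 1 else 0) ^ 2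
      = outWeight A S + outWeight A Sᶜ := by
  rw [← Finset.sum_add_sum_compl S, outWeight, outWeight, compl_compl]
  congr 1 <;> refine Finset.sum_congr rfl fun i hi => ?_
  · rw [← Finset.sum_add_sum_compl S, Finset.sum_eq_zero, zero_add]
    · refine Finset.sum_congr rfl fun j hj => ?_
      rw [if_pos hi, if_neg (Finset.mem_compl.1 hj)]
      ring
    · intro j hj
      rw [if_pos hi, if_pos hj]
      ring
  · rw [← Finset.sum_add_sum_compl S, add_comm, Finset.sum_eq_zero, zero_add]
    · refine Finset.sum_congr rfl fun j hj => ?_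
      rw [if_pos hj, if_neg (Finset.mem_compl.1 hi)]
      ring
    · intro j hj
      rw [if_neg (Finset.mem_compl.1 hi), if_neg (Finset.mem_compl.1 hj)]
      ring

/-- The easy direction of Cheeger's inequality, applied to the union of the matchings. -/
lemma le_edgeExpansion_of_potential_le [Nontrivial V] (hπ : ∀ i, 0 < π i) {h : History V}
    (hA : IsEulerian (union h)) {a : ℝ} (ha : 0 ≤ a) (hpot : potential π h ≤ Real.exp (-a)) :
    8 * a ≤ edgeExpansion π (union h) := by
  refine le_edgeExpansion hπ hA fun S hS hSc => ?_
  have hs : 0 < weight π S := Finset.sum_pos (fun i _ => hπ i) hS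
  have hsc : 0 < weight π Sᶜ := Finset.sum_pos (fun i _ => hπ i) hSc
  have hsum := weight_add_weight_compl π S
  set s := weight π S with hs_def
  set s' := weight π Sᶜ
  set W := weight π Finset.univ with hW_def
  have hW : 0 < W := by linarith
  -- The indicator vector of `S`, centred so that `x` is orthogonal to `Π^{1/2} 1`.
  set x : V → ℝ := fun i => √(π i) * ((if i ∈ S then (1 : ℝ) else 0) - s / W) with hx
  have hS1 : ∑ i, π i * (if i ∈ S then (1 : ℝ) else 0) = s := by
    simp [hs_def, weight]
  have hxx : x ⬝ᵥ x = s * s' / W := by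
    have h1 : x ⬝ᵥ x = ∑ i, π i * (if i ∈ S then (1 : ℝ) else 0) * (1 - 2 * (s / W))
        + ∑ i, π i * (s / W) ^ 2 := by
      rw [← Finset.sum_add_distrib]
      refine Finset.sum_congr rfl fun i _ => ?_
      have := Real.mul_self_sqrt (hπ i).le
      calc x i * x i = (√(π i) * √(π i)) * ((if i ∈ S then (1 : ℝ) else 0) - s / W) ^ 2 := by
            rw [hx]; ring
        _ = _ := by
          rw [this]
          split_ifs <;> ring
    rw [h1, ← Finset.sum_mul, ← Finset.sum_mul, hS1]
    change s * (1 - 2 * (s / W)) + W * (s / W) ^ 2 = _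
    field_simp
    rw [← hsum]
    ring
  have hxs : x ⬝ᵥ (fun i => √(π i)) = 0 := by
    have h1 : x ⬝ᵥ (fun i => √(π i))
        = ∑ i, π i * (if i ∈ S then (1 : ℝ) else 0) - ∑ i, π i * (s / W) := by
      rw [← Finset.sum_sub_distrib]
      refine Finset.sum_congr rfl fun i _ => ?_
      have := Real.mul_self_sqrt (hπ i).le
      calc x i * √(π i) = (√(π i) * √(π i)) * ((if i ∈ S then (1 : ℝ) else 0) - s / W) := by
            rw [hx]; ring
        _ = _ := by rw [this]; ring
    rw [h1, hS1, ← Finset.sum_mul]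
    change s - W * (s / W) = 0
    field_simp
    ring
  have hq : x ⬝ᵥ feedback π (union h) *ᵥ x = outWeight (union h) S := by
    rw [dotProduct_feedback_mulVec]
    have h1 : ∀ i, (√(π i))⁻¹ * x i = (if i ∈ S then (1 : ℝ) else 0) - s / W := fun i =>
      inv_mul_cancel_left₀ (Real.sqrt_pos.2 (hπ i)).ne' _
    simp only [h1, sub_sub_sub_cancel_right]
    rw [sum_sum_mul_indicator_sub_sq, hA.outWeight_compl]
    ring
  have hxpos : 0 < x ⬝ᵥ x := by rw [hxx]; positivity
  have h2 := (exp_le_potential hπ h hxpos hxs).trans hpot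
  rw [Real.exp_le_exp, div_le_iff₀ hxpos, hq, hxx] at h2
  have h3 : min s s' / 2 ≤ s * s' / W := by
    rw [div_le_div_iff₀ (by norm_num) hW, ← hsum]
    rcases le_total s s' with hle | hle
    · rw [min_eq_left hle]; nlinarith
    · rw [min_eq_right hle]; nlinarith
  nlinarith [mul_le_mul_of_nonneg_left h3 ha]

/-! ### Expectations over the course of the game -/

lemma tsum_bind_mul {α β : Type*} (p : PMF α) (f : α → PMF β) (g : β → ℝ≥0∞) :
    ∑' b, (p.bind f) b * g b = ∑' a, p a * ∑' b, f a b * g b := by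
  simp only [PMF.bind_apply, ← ENNReal.tsum_mul_right, ← ENNReal.tsum_mul_left]
  rw [ENNReal.tsum_comm]
  exact tsum_congr fun a => tsum_congr fun b => by rw [mul_assoc]

lemma tsum_pure_mul {α : Type*} (a : α) (g : α → ℝ≥0∞) : ∑' b, PMF.pure a b * g b = g a := by
  rw [tsum_eq_single a fun b hb => by rw [PMF.pure_apply_of_ne _ _ hb, zero_mul],
    PMF.pure_apply_self, one_mul]

lemma tsum_map_mul {α β : Type*} (p : PMF α) (f : α → β) (g : β → ℝ≥0∞) :
    ∑' b, (p.map f) b * g b = ∑' a, p a * g (f a) := by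
  rw [PMF.map, tsum_bind_mul]
  simp only [Function.comp_apply, tsum_pure_mul]

/-- What holds at the start and is preserved by every possible round holds almost surely. -/
lemma play_induction {σ : CutStrategy V} {τ : MatchingStrategy V} {P : ℕ → History V → Prop}
    (h0 : P 0 []) (hstep : ∀ t h L D, P t h → L ∈ (σ h).support → D ∈ (τ h L).support →
      P (t + 1) (h ++ [(L, D)])) (t : ℕ) : ∀ h ∈ (play σ τ t).support, P t h := by
  induction t with
  | zero =>
    intro h hh
    rw [play, PMF.mem_support_pure_iff] at hh
    exact hh ▸ h0
  | succ t ih =>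
    intro h hh
    rw [play, PMF.mem_support_bind_iff] at hh
    obtain ⟨h', hh', hh⟩ := hh
    rw [PMF.mem_support_bind_iff] at hh
    obtain ⟨L, hL, hh⟩ := hh
    rw [PMF.mem_support_map_iff] at hh
    obtain ⟨D, hD, rfl⟩ := hh
    exact hstep t h' L D (ih h' hh') hL hD

/-- A supermartingale inequality in every round gives a bound on the expectation. -/
lemma tsum_play_mul_le {σ : CutStrategy V} {τ : MatchingStrategy V} {F : History V → ℝ≥0∞}
    {q : ℝ≥0∞} (hstep : ∀ h, ∑' L, σ h L * ∑' D, τ h L D * F (h ++ [(L, D)]) ≤ F h * q) (t : ℕ) :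
    ∑' h, play σ τ t h * F h ≤ F [] * q ^ t := by
  induction t with
  | zero => rw [play, tsum_pure_mul, pow_zero, mul_one]
  | succ t ih =>
    rw [play, tsum_bind_mul]
    simp only [tsum_bind_mul, tsum_map_mul]
    calc _ ≤ ∑' h, play σ τ t h * F h * q := ENNReal.tsum_le_tsum fun h => by
          rw [mul_assoc]
          gcongr
          exact hstep h
      _ = (∑' h, play σ τ t h * F h) * q := ENNReal.tsum_mul_right
      _ ≤ F [] * q ^ t * q := by gcongr
      _ = _ := by rw [pow_succ, mul_assoc]

/-! ### The strategy without a heavy vertex -/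

lemma mmwuStrategy_of_light (hlight : ∀ i, π i < weight π Finset.univ / 4) (h : History V)
    (L : Finset V) : mmwuStrategy π h L
      = gaussian V {u | medianCut π (u ᵥ* embedding π h) = L} := by
  have : ¬∃ i, weight π Finset.univ / 4 ≤ π i := by simpa using hlight
  rw [mmwuStrategy, dif_neg this, PMF.ofFintype_apply]

lemma exists_of_mem_support_mmwuStrategy [Nontrivial V] (hπ : ∀ i, 0 < π i)
    (hlight : ∀ i, π i < weight π Finset.univ / 4) {h : History V} {L : Finset V}
    (hL : L ∈ (mmwuStrategy π h).support) :
    ∃ x : V → ℝ, Function.Injective x ∧ medianCut π x = L := by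
  rw [PMF.mem_support_iff, mmwuStrategy_of_light hlight] at hL
  obtain ⟨u, hu, hinj⟩ := ((frequently_ae_mem_iff.2 hL).and_eventually
    (ae_injective_vecMul_embedding hπ h)).exists
  exact ⟨_, hinj, hu⟩

lemma measurableSet_medianCut_vecMul (π : V → ℝ) (B : Matrix V V ℝ) (L : Finset V) :
    MeasurableSet {u | medianCut π (u ᵥ* B) = L} := by
  have hB : Measurable fun u : V → ℝ => u ᵥ* B :=
    measurable_pi_lambda _ fun i => measurable_dotProduct_right _
  exact hB (measurableSet_medianCut π L)

/-- In expectation over the cut, the potential drops by a factor `1 - Ω(1 / log n)` in every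
round, whatever the history and the answer. -/
lemma tsum_mmwuStrategy_potential_le [Nontrivial V] (hπ : ∀ i, 0 < π i)
    (hlight : ∀ i, π i < weight π Finset.univ / 4) {τ : MatchingStrategy V} (hτ : τ.IsLegal π)
    (h : History V) :
    ∑' L, mmwuStrategy π h L * ∑' D, τ h L D * ENNReal.ofReal (potential π (h ++ [(L, D)]))
      ≤ ENNReal.ofReal (potential π h)
        * ENNReal.ofReal (1 - 1 / (4000 * Real.log (Fintype.card V))) := by
  have hn : (5 : ℝ) ≤ Fintype.card V := by exact_mod_cast five_le_card hπ hlight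
  have hlog : 0 < Real.log (Fintype.card V) := Real.log_pos (by linarith)
  set ℓ := Real.log (Fintype.card V)
  set B := embedding π h
  set cut : (V → ℝ) → Finset V := fun u => medianCut π (u ᵥ* B)
  set g := truncatedMoment π B (32 * ℓ)
  have hpot := potential_pos hπ h
  set f : (V → ℝ) → ℝ := fun u => potential π h * (1 - 7 / 144 * (g u / (96 * ℓ)))
  have hgood : ∀ᵐ u ∂gaussian V, IsBalancedCut π (cut u) := by
    filter_upwards [ae_injective_vecMul_embedding hπ h] with u hu
    exact isBalancedCut_medianCut hπ hlight hu
  have hdrop : ∀ u, IsBalancedCut π (cut u) → ∀ D ∈ (τ h (cut u)).support,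
      potential π (h ++ [(cut u, D)]) ≤ f u := by
    intro u hu D hD
    obtain ⟨hne, hne'⟩ := hu.nonempty hπ
    have hM := hτ h (cut u) hne hne' D hD
    refine (potential_append_le hπ h (cut u) hM.nonneg (fun i => (hM.degree_bounds hπ hu i).2)
      (fun i => hM.balanced i ▸ (hM.degree_bounds hπ hu i).2)).trans ?_
    refine mul_le_mul_of_nonneg_left ?_ hpot.le
    have h1 := truncatedMoment_le_loss hπ h (K := 32 * ℓ) (by positivity) hu hM
    have h2 : g u / (96 * ℓ) ≤ (feedback π D * density π h).trace := by
      rw [div_le_iff₀ (by positivity)]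
      linarith
    linarith
  have hfi : Integrable f (gaussian V) :=
    (((integrable_const _).sub
      (((integrable_truncatedMoment π B (32 * ℓ)).div_const _).const_mul _)).const_mul _)
  -- The bound `f` dominates the potential after some answer, so `ENNReal.ofReal` loses nothing.
  have hf0 : 0 ≤ᵐ[gaussian V] f := by
    filter_upwards [hgood] with u hu
    obtain ⟨D, hD⟩ := (τ h (cut u)).support_nonempty
    exact (potential_pos hπ _).le.trans (hdrop u hu D hD)
  have hint : ∫ u, f u ∂gaussian V ≤ potential π h * (1 - 1 / (4000 * ℓ)) := by
    have hg := half_le_integral_truncatedMoment hπ hlight h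
    rw [integral_const_mul, integral_sub (integrable_const _)
      (((integrable_truncatedMoment π B (32 * ℓ)).div_const _).const_mul _), integral_const_mul,
      integral_div]
    simp only [integral_const, probReal_univ, smul_eq_mul, mul_one]
    refine mul_le_mul_of_nonneg_left ?_ hpot.le
    have : 1 / (4000 * ℓ) ≤ 7 / 144 * ((1 / 2) / (96 * ℓ)) := by
      rw [show 7 / 144 * ((1 / 2) / (96 * ℓ)) = 7 / (27648 * ℓ) by field_simp; norm_num,
        div_le_div_iff₀ (by positivity) (by positivity)]
      nlinarith
    have h2 : (1 / 2) / (96 * ℓ) ≤ (∫ u, g u ∂gaussian V) / (96 * ℓ) := by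
      gcongr
    linarith
  rw [tsum_fintype, ← ENNReal.ofReal_mul hpot.le]
  calc ∑ L, mmwuStrategy π h L * ∑' D, τ h L D * ENNReal.ofReal (potential π (h ++ [(L, D)]))
      ≤ ∑ L, ∫⁻ u in {u | cut u = L}, ENNReal.ofReal (f u) ∂gaussian V := by
        refine Finset.sum_le_sum fun L _ => ?_
        rw [mmwuStrategy_of_light hlight, mul_comm, ← setLIntegral_const]
        refine setLIntegral_mono_ae' (measurableSet_medianCut_vecMul π B L) ?_
        filter_upwards [hgood] with u hu hL
        have hL' : cut u = L := hL
        subst hL'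
        calc _ ≤ ∑' D, τ h (cut u) D * ENNReal.ofReal (f u) := ENNReal.tsum_le_tsum fun D => by
              by_cases hD : τ h (cut u) D = 0
              · rw [hD, zero_mul, zero_mul]
              · gcongr
                exact hdrop u hu D hD
          _ = ENNReal.ofReal (f u) := by
            rw [ENNReal.tsum_mul_right, PMF.tsum_coe, one_mul]
    _ = ∫⁻ u, ENNReal.ofReal (f u) ∂gaussian V := by
        rw [← lintegral_biUnion_finset]
        · have : (⋃ L ∈ (Finset.univ : Finset (Finset V)), {u | cut u = L}) = Set.univ := by
            ext u
            simp
          rw [this, setLIntegral_univ]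
        · intro L _ L' _ hne
          exact Set.disjoint_left.2 fun u hu hu' => hne (hu.symm.trans hu')
        · exact fun L _ => measurableSet_medianCut_vecMul π B L
    _ = ENNReal.ofReal (∫ u, f u ∂gaussian V) := (ofReal_integral_eq_lintegral_ofReal hfi hf0).symm
    _ ≤ _ := ENNReal.ofReal_le_ofReal hint

lemma IsBalancedCut.of_mem_support_mmwuStrategy [Nontrivial V] (hπ : ∀ i, 0 < π i)
    (hlight : ∀ i, π i < weight π Finset.univ / 4) {h : History V} {L : Finset V}
    (hL : L ∈ (mmwuStrategy π h).support) : IsBalancedCut π L := by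
  obtain ⟨x, hx, rfl⟩ := exists_of_mem_support_mmwuStrategy hπ hlight hL
  exact isBalancedCut_medianCut hπ hlight hx

lemma isEulerian_union_of_mem_support {σ : CutStrategy V} {τ : MatchingStrategy V}
    (hτ : τ.IsLegal π) (hσ : ∀ h, ∀ L ∈ (σ h).support, L.Nonempty ∧ Lᶜ.Nonempty) {t : ℕ}
    {h : History V} (hh : h ∈ (play σ τ t).support) : IsEulerian (union h) := by
  refine play_induction (P := fun _ h => IsEulerian (union h)) ?_ ?_ t h hh
  · exact isEulerian_zero
  · intro t h L D hh hL hD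
    rw [union_append]
    exact hh.add (hτ h L (hσ h L hL).1 (hσ h L hL).2 D hD).isEulerian

lemma potential_nil (π : V → ℝ) : potential π [] = Fintype.card V - 1 := by
  have : feedback π (union ([] : History V)) = 0 := by
    have h0 : union ([] : History V) = 0 := rfl
    rw [h0, feedback, symLaplacian_zero, Matrix.mul_zero, Matrix.zero_mul]
  rw [potential, expFeedback_eq, this, smul_zero, NormedSpace.exp_zero, trace_one]

/-- Markov's inequality for the potential after the last round. -/
lemma one_le_winProb_add_of_light [Nontrivial V] (hπ : ∀ i, 0 < π i)
    (hlight : ∀ i, π i < weight π Finset.univ / 4) {τ : MatchingStrategy V} (hτ : τ.IsLegal π)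
    {m : ℝ} (hm : 0 ≤ m) {T : ℕ}
    (hT : 4000 * (2 + m) * Real.log (Fintype.card V) ^ 2 ≤ T) :
    1 ≤ winProb π (mmwuStrategy π) τ T (8 * Real.log (Fintype.card V))
      + ENNReal.ofReal (Real.exp (-m)) := by
  have hn : (5 : ℝ) ≤ Fintype.card V := by exact_mod_cast five_le_card hπ hlight
  have hlog : 1 ≤ Real.log (Fintype.card V) := by
    rw [Real.le_log_iff_exp_le (by linarith)]
    linarith [Real.exp_one_lt_d9]
  have hnil := potential_nil π
  have hexp : (Fintype.card V : ℝ) = Real.exp (Real.log (Fintype.card V)) :=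
    (Real.exp_log (by linarith)).symm
  set n : ℝ := (Fintype.card V : ℝ)
  set ℓ := Real.log n
  set P := play (mmwuStrategy π) τ T
  set good : Set (History V) := {h | IsEulerian (union h) ∧ 8 * ℓ ≤ edgeExpansion π (union h)}
  have hmean : ∑' h, P h * ENNReal.ofReal (potential π h)
      ≤ ENNReal.ofReal (n * Real.exp (-(2 + m) * ℓ)) := by
    refine (tsum_play_mul_le (tsum_mmwuStrategy_potential_le hπ hlight hτ) T).trans ?_
    have hr : 1 / (4000 * ℓ) ≤ 1 := by
      rw [div_le_one (by positivity)]
      linarith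
    rw [← ENNReal.ofReal_pow (by change 0 ≤ 1 - 1 / (4000 * ℓ); linarith),
      ← ENNReal.ofReal_mul (potential_pos hπ []).le, hnil]
    refine ENNReal.ofReal_le_ofReal ?_
    have h1 : (1 - 1 / (4000 * ℓ)) ^ T ≤ Real.exp (-(2 + m) * ℓ) := by
      calc (1 - 1 / (4000 * ℓ)) ^ T ≤ Real.exp (-(1 / (4000 * ℓ))) ^ T :=
            pow_le_pow_left₀ (by linarith) (Real.one_sub_le_exp_neg _) T
        _ = Real.exp (T * -(1 / (4000 * ℓ))) := (Real.exp_nat_mul _ T).symm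
        _ ≤ _ := by
          rw [Real.exp_le_exp, mul_neg, neg_mul, neg_le_neg_iff, mul_one_div,
            le_div_iff₀ (by positivity)]
          linarith
    have h2 : 0 ≤ (1 - 1 / (4000 * ℓ)) ^ T := pow_nonneg (by linarith) T
    exact mul_le_mul (by linarith) h1 h2 (by linarith)
  have hbad : P.toOuterMeasure goodᶜ ≤ ENNReal.ofReal (Real.exp (-m)) := by
    calc P.toOuterMeasure goodᶜ
        ≤ ∑' h, P h * ENNReal.ofReal (potential π h) * ENNReal.ofReal n := by
          rw [PMF.toOuterMeasure_apply]
          refine ENNReal.tsum_le_tsum fun h =>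
            Set.indicator_apply_le' (fun hh => ?_) fun _ => zero_le
          by_cases h0 : P h = 0
          · simp [h0]
          have hE : IsEulerian (union h) := isEulerian_union_of_mem_support hτ
            (fun h L hL => (IsBalancedCut.of_mem_support_mmwuStrategy hπ hlight hL).nonempty hπ) h0
          have hpot : Real.exp (-ℓ) < potential π h := by
            by_contra! hle
            exact hh ⟨hE, le_edgeExpansion_of_potential_le hπ hE (by linarith) hle⟩
          have h1 : 1 ≤ ENNReal.ofReal (potential π h) * ENNReal.ofReal n := by
            rw [← ENNReal.ofReal_mul (potential_pos hπ h).le, ENNReal.one_le_ofReal, hexp]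
            calc (1 : ℝ) = Real.exp (-ℓ) * Real.exp ℓ := by rw [← Real.exp_add]; simp
              _ ≤ _ := by gcongr
          rw [mul_assoc]
          exact le_mul_of_one_le_right zero_le h1
      _ ≤ ENNReal.ofReal (n * Real.exp (-(2 + m) * ℓ)) * ENNReal.ofReal n := by
          rw [ENNReal.tsum_mul_right]
          gcongr
      _ ≤ _ := by
          rw [← ENNReal.ofReal_mul (by positivity)]
          refine ENNReal.ofReal_le_ofReal ?_
          rw [hexp, ← Real.exp_add, ← Real.exp_add, Real.exp_le_exp]
          nlinarith
  have huniv : P.toOuterMeasure (good ∪ goodᶜ) = 1 :=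
    (P.toOuterMeasure_apply_eq_one_iff _).2 (by rw [Set.union_compl_self]; exact Set.subset_univ _)
  calc 1 = P.toOuterMeasure (good ∪ goodᶜ) := huniv.symm
    _ ≤ P.toOuterMeasure good + P.toOuterMeasure goodᶜ := measure_union_le _ _
    _ ≤ _ := add_le_add le_rfl hbad

/-! ### The strategy with a heavy vertex -/

lemma one_le_winProb {σ : CutStrategy V} {τ : MatchingStrategy V} {T : ℕ} {φ : ℝ}
    (h : ∀ h ∈ (play σ τ T).support, IsEulerian (union h) ∧ φ ≤ edgeExpansion π (union h)) :
    1 ≤ winProb π σ τ T φ :=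
  ((PMF.toOuterMeasure_apply_eq_one_iff _ _).2 h).ge

/-- A matching at a single vertex is a star. -/
lemma min_weight_le_outWeight_of_singleton {v : V} {D : Matrix V V ℝ}
    (hD : IsDirectedMatching π {v} D) (S : Finset V) :
    min (weight π S) (weight π Sᶜ) ≤ outWeight D S := by
  have hzero : ∀ i j, i ≠ v → j ≠ v → D i j = 0 := by
    intro i j hi hj
    by_contra h0
    have := hD.crossing i j h0
    simp only [Finset.mem_singleton] at this
    exact hi (this.2 hj)
  by_cases hv : v ∈ S
  · refine (min_le_right _ _).trans ?_
    rw [outWeight, Finset.sum_comm (f := fun i j => D i j)]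
    refine Finset.sum_le_sum fun j hj => ?_
    have hjv : j ≠ v := fun h => Finset.mem_compl.1 hj (h ▸ hv)
    rw [← hD.in_right j (by simpa using hjv),
      Finset.sum_eq_single_of_mem v (Finset.mem_univ v) fun i _ hi => hzero i j hi hjv]
    exact Finset.single_le_sum (f := fun i => D i j) (fun i _ => hD.nonneg i j) hv
  · refine (min_le_left _ _).trans (Finset.sum_le_sum fun i hi => ?_)
    have hiv : i ≠ v := fun h => hv (h ▸ hi)
    rw [← hD.out_right i (by simpa using hiv),
      Finset.sum_eq_single_of_mem v (Finset.mem_univ v) fun j _ hj => hzero i j hiv hj]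
    exact Finset.single_le_sum (f := fun j => D i j) (fun j _ => hD.nonneg i j)
      (Finset.mem_compl.2 hv)

lemma exists_mmwuStrategy_eq_of_heavy (hheavy : ∃ i, weight π Finset.univ / 4 ≤ π i) :
    ∃ v, ∀ h, mmwuStrategy π h = PMF.pure {v} :=
  ⟨hheavy.choose, fun _ => dif_pos hheavy⟩

lemma one_le_winProb_of_heavy [Nontrivial V] (hπ : ∀ i, 0 < π i)
    (hheavy : ∃ i, weight π Finset.univ / 4 ≤ π i) {τ : MatchingStrategy V} (hτ : τ.IsLegal π)
    {T : ℕ} {φ : ℝ} (hφ : φ ≤ T) : 1 ≤ winProb π (mmwuStrategy π) τ T φ := by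
  obtain ⟨v, hv⟩ := exists_mmwuStrategy_eq_of_heavy hheavy
  have hinv := play_induction (σ := mmwuStrategy π) (τ := τ)
    (P := fun t h => IsEulerian (union h) ∧
      ∀ S, t * min (weight π S) (weight π Sᶜ) ≤ outWeight (union h) S)
    ⟨isEulerian_zero, fun S => by simp [union, matchings, outWeight]⟩
    (by
      intro t h L D ⟨hE, hS⟩ hL hD
      rw [hv, PMF.mem_support_pure_iff] at hL
      subst hL
      obtain ⟨w, hw⟩ := exists_ne v
      have hM := hτ h {v} (Finset.singleton_nonempty v) ⟨w, by simpa using hw⟩ D hD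
      rw [union_append]
      refine ⟨hE.add hM.isEulerian, fun S => ?_⟩
      rw [outWeight_add]
      push_cast
      linarith [hS S, min_weight_le_outWeight_of_singleton hM S]) T
  refine one_le_winProb fun h hh => ?_
  obtain ⟨hE, hS⟩ := hinv h hh
  refine ⟨hE, hφ.trans (le_edgeExpansion hπ hE fun S _ _ => hS S)⟩

/-! ### Bisections of four vertices -/

/-- The three bisections of four vertices. -/
def bisection : Fin 3 → Finset (Fin 4) := ![{0, 1}, {0, 2}, {0, 3}]

/-- The cut player who plays the three bisections of four vertices in turn. -/
noncomputable def bisectionStrategy : CutStrategy (Fin 4) := fun h =>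
  PMF.pure (bisection (Fin.ofNat 3 h.length))

/-- The difference of the numbers of vertices of `S` on the two sides of a cut. -/
def imbalance (L S : Finset V) : ℕ :=
  ((S ∩ L).card - (S ∩ Lᶜ).card) + ((S ∩ Lᶜ).card - (S ∩ L).card)

lemma card_sub_card_le_outWeight {D : Matrix V V ℝ} (hD : ∀ i j, 0 ≤ D i j) {L : Finset V}
    (hL : ∀ i ∈ L, ∀ j ∈ L, D i j = 0) (hout : ∀ i, ∑ j, D i j = 1) (hin : ∀ j, ∑ i, D i j = 1)
    (S : Finset V) : ((S ∩ L).card : ℝ) - (S ∩ Lᶜ).card ≤ outWeight D S := by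
  have h1 : ((S ∩ L).card : ℝ)
      = ∑ i ∈ S ∩ L, ∑ j ∈ S, D i j + ∑ i ∈ S ∩ L, ∑ j ∈ Sᶜ, D i j := by
    rw [← Finset.sum_add_distrib]
    simp only [Finset.sum_add_sum_compl, hout, Finset.sum_const, nsmul_eq_mul, mul_one]
  have h2 : ∑ i ∈ S ∩ L, ∑ j ∈ Sᶜ, D i j ≤ outWeight D S :=
    Finset.sum_le_sum_of_subset_of_nonneg Finset.inter_subset_left fun i _ _ =>
      Finset.sum_nonneg fun j _ => hD i j
  have h3 : ∑ i ∈ S ∩ L, ∑ j ∈ S, D i j ≤ (S ∩ Lᶜ).card := by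
    calc ∑ i ∈ S ∩ L, ∑ j ∈ S, D i j = ∑ i ∈ S ∩ L, ∑ j ∈ S ∩ Lᶜ, D i j := by
          refine Finset.sum_congr rfl fun i hi => ?_
          refine (Finset.sum_subset Finset.inter_subset_left fun j hj hj' => ?_).symm
          refine hL i (Finset.mem_inter.1 hi).2 j ?_
          by_contra hjL
          exact hj' (Finset.mem_inter.2 ⟨hj, Finset.mem_compl.2 hjL⟩)
      _ = ∑ j ∈ S ∩ Lᶜ, ∑ i ∈ S ∩ L, D i j := Finset.sum_comm
      _ ≤ ∑ j ∈ S ∩ Lᶜ, ∑ i, D i j := Finset.sum_le_sum fun j _ =>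
          Finset.sum_le_sum_of_subset_of_nonneg (Finset.subset_univ _) fun i _ _ => hD i j
      _ = _ := by simp only [hin, Finset.sum_const, nsmul_eq_mul, mul_one]
  linarith

/-- The neighbours of the vertices of `S` on one side lie on the other side, where `S` has not
enough vertices for them. -/
lemma imbalance_le_outWeight {L : Finset V} (hL : L.card = Lᶜ.card) {D : Matrix V V ℝ}
    (hD : IsDirectedMatching (fun _ => 1) L D) (S : Finset V) :
    (imbalance L S : ℝ) ≤ outWeight D S := by
  have hw : ∀ S : Finset V, weight (fun _ => 1) S = S.card := fun S => by simp [weight]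
  have hout : ∀ i, ∑ j, D i j = 1 := by
    intro i
    by_cases hi : i ∈ L
    · have : (L.card : ℝ) ≠ 0 := by
        exact_mod_cast (Finset.card_pos.2 ⟨i, hi⟩).ne'
      rw [hD.out_left i hi, hw, hw, ← hL, mul_one, div_self this]
    · exact hD.out_right i (Finset.mem_compl.2 hi)
  have hin : ∀ j, ∑ i, D i j = 1 := fun j => (hD.balanced j).symm.trans (hout j)
  have h1 := card_sub_card_le_outWeight hD.nonneg (L := L)
    (fun i hi j hj => by_contra fun h0 => (hD.crossing i j h0).1 hi hj) hout hin S
  have h2 := card_sub_card_le_outWeight hD.nonneg (L := Lᶜ)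
    (fun i hi j hj => by_contra fun h0 =>
      Finset.mem_compl.1 hi ((hD.crossing i j h0).2 (Finset.mem_compl.1 hj))) hout hin S
  rw [compl_compl] at h2
  rw [imbalance]
  rcases le_total (S ∩ L).card (S ∩ Lᶜ).card with h | h
  · rw [Nat.sub_eq_zero_of_le h, zero_add, Nat.cast_sub h]
    exact h2
  · rw [Nat.sub_eq_zero_of_le h, add_zero, Nat.cast_sub h]
    exact h1

lemma card_bisection (r : Fin 3) : (bisection r).card = 2 ∧ (bisection r)ᶜ.card = 2 := by
  revert r
  decide

lemma min_card_le_sum_imbalance : ∀ S : Finset (Fin 4), min S.card Sᶜ.card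
    ≤ imbalance (bisection 0) S + imbalance (bisection 1) S + imbalance (bisection 2) S := by
  decide

lemma div_three_mul_min_card_le (S : Finset (Fin 4)) (t : ℕ) : t / 3 * min S.card Sᶜ.card
    ≤ ∑ s ∈ Finset.range t, imbalance (bisection (Fin.ofNat 3 s)) S := by
  have hq : ∀ q : ℕ, q * min S.card Sᶜ.card
      ≤ ∑ s ∈ Finset.range (3 * q), imbalance (bisection (Fin.ofNat 3 s)) S := by
    intro q
    induction q with
    | zero => simp
    | succ q ih =>
      have h0 : Fin.ofNat 3 (3 * q) = 0 := Fin.ext (by simp)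
      have h1 : Fin.ofNat 3 (3 * q + 1) = 1 := Fin.ext (by simp [Nat.add_mod])
      have h2 : Fin.ofNat 3 (3 * q + 2) = 2 := Fin.ext (by simp [Nat.add_mod])
      rw [show 3 * (q + 1) = 3 * q + 1 + 1 + 1 by ring, Finset.sum_range_succ,
        Finset.sum_range_succ, Finset.sum_range_succ, h0, h1, h2, add_mul, one_mul]
      linarith [min_card_le_sum_imbalance S]
  exact (hq (t / 3)).trans (Finset.sum_le_sum_of_subset
    (Finset.range_mono (Nat.mul_div_le t 3)))

lemma one_le_winProb_bisectionStrategy {τ : MatchingStrategy (Fin 4)}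
    (hτ : τ.IsLegal fun _ => 1) {T : ℕ} {φ : ℝ} (hφ : φ ≤ (T / 3 : ℕ)) :
    1 ≤ winProb (fun _ => 1) bisectionStrategy τ T φ := by
  have hinv := play_induction (σ := bisectionStrategy) (τ := τ)
    (P := fun t h => h.length = t ∧ IsEulerian (union h) ∧
      ∀ S, ((∑ s ∈ Finset.range t, imbalance (bisection (Fin.ofNat 3 s)) S : ℕ) : ℝ)
        ≤ outWeight (union h) S)
    ⟨rfl, isEulerian_zero, fun S => by simp [union, matchings, outWeight]⟩
    (by
      rintro t h L D ⟨rfl, hE, hS⟩ hL hD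
      rw [bisectionStrategy, PMF.mem_support_pure_iff] at hL
      subst hL
      obtain ⟨hc, hc'⟩ := card_bisection (Fin.ofNat 3 h.length)
      have hM := hτ h _ (Finset.card_pos.1 (by omega)) (Finset.card_pos.1 (by omega)) D hD
      rw [union_append]
      refine ⟨by simp, hE.add hM.isEulerian, fun S => ?_⟩
      rw [outWeight_add, Finset.sum_range_succ]
      push_cast
      have := hS S
      push_cast at this
      linarith [imbalance_le_outWeight (hc.trans hc'.symm) hM S]) T
  refine one_le_winProb fun h hh => ?_
  obtain ⟨-, hE, hS⟩ := hinv h hh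
  refine ⟨hE, hφ.trans (le_edgeExpansion (fun _ => one_pos) hE fun S _ _ => ?_)⟩
  have hw : ∀ S : Finset (Fin 4), weight (fun _ => 1) S = S.card := fun S => by simp [weight]
  rw [hw, hw]
  refine le_trans ?_ (hS S)
  exact_mod_cast div_three_mul_min_card_le S T

/-! ### The game -/

/-- Without ties and with equal weights, the median cut of an even number of vertices is a
bisection. -/
lemma two_mul_card_medianCut {n : ℕ} (hn : 2 ≤ n) (heven : Even n) {x : Fin n → ℝ}
    (hx : Function.Injective x) : 2 * (medianCut (fun _ => 1) x).card = n := by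
  have : NeZero n := ⟨by omega⟩
  obtain ⟨h1, k, hk⟩ := weight_medianCut (π := fun _ => 1) (fun _ => one_pos) hx
  simp only [weight, Finset.sum_const, Finset.card_univ, Fintype.card_fin, nsmul_eq_mul,
    mul_one] at h1 hk
  have h2 : n ≤ 2 * (medianCut (fun _ => 1) x).card := by
    have : (n : ℝ) ≤ 2 * (medianCut (fun _ => 1) x).card := by linarith
    exact_mod_cast this
  have h3 : 2 * (medianCut (fun _ => 1) x).card < n + 2 := by
    have : 2 * ((medianCut (fun _ => 1) x).card : ℝ) < n + 2 := by linarith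
    exact_mod_cast this
  obtain ⟨r, rfl⟩ := heven
  omega

lemma ofReal_le_winProb_mmwuStrategy {n : ℕ} (hn : 2 ≤ n) {π : Fin n → ℝ} (hπ : ∀ i, 0 < π i)
    {τ : MatchingStrategy (Fin n)} (hτ : τ.IsLegal π) {m p : ℝ} (hm : 0 ≤ m)
    (hp : Real.exp (-m) ≤ 1 - p) :
    ENNReal.ofReal p ≤ winProb π (mmwuStrategy π) τ (rounds (4000 * (2 + m)) n)
      (8 * Real.log n) := by
  have : Nontrivial (Fin n) := Fin.nontrivial_iff_two_le.2 hn
  have hT : 4000 * (2 + m) * Real.log n ^ 2 ≤ rounds (4000 * (2 + m)) n := Nat.le_ceil _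
  have hcancel : ∀ w : ℝ≥0∞, 1 ≤ w + ENNReal.ofReal (Real.exp (-m)) → ENNReal.ofReal p ≤ w := by
    intro w hw
    rcases le_or_gt p 0 with hp0 | hp0
    · rw [ENNReal.ofReal_of_nonpos hp0]
      exact zero_le
    · have h1 : ENNReal.ofReal p + ENNReal.ofReal (Real.exp (-m))
          ≤ w + ENNReal.ofReal (Real.exp (-m)) := by
        rw [← ENNReal.ofReal_add hp0.le (Real.exp_pos _).le]
        refine le_trans ?_ hw
        rw [ENNReal.ofReal_le_one]
        linarith
      exact (ENNReal.add_le_add_iff_right ENNReal.ofReal_ne_top).1 h1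
  by_cases hheavy : ∃ i, weight π Finset.univ / 4 ≤ π i
  · refine hcancel _ (le_add_right (one_le_winProb_of_heavy hπ hheavy hτ (le_trans ?_ hT)))
    have hlog : 1 / 2 ≤ Real.log n := by
      have h1 : Real.log 2 ≤ Real.log n := Real.log_le_log (by norm_num) (by exact_mod_cast hn)
      linarith [Real.log_two_gt_d9]
    nlinarith [mul_nonneg hm (sq_nonneg (Real.log n))]
  · push Not at hheavy
    refine hcancel _ ?_
    have := one_le_winProb_add_of_light hπ hheavy hτ hm (T := rounds (4000 * (2 + m)) n)
      (by rwa [Fintype.card_fin])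
    rwa [Fintype.card_fin] at this

end CutMatching

theorem mainTheorem5 :
    ∀ p : ℝ, p < 1 → ∃ C : ℝ, 0 < C ∧ ∃ c : ℝ, 0 < c ∧
      (∀ (n : ℕ), 2 ≤ n → ∀ (π : Fin n → ℝ), (∀ i, 0 < π i) →
        ∀ (τ : CutMatching.MatchingStrategy (Fin n)), τ.IsLegal π →
          ENNReal.ofReal p ≤ CutMatching.winProb π (CutMatching.mmwuStrategy π) τ
            (CutMatching.rounds C n) (c * Real.log n)) ∧
      (∀ (n : ℕ), 2 ≤ n → Even n →
        ∃ σ : CutMatching.CutStrategy (Fin n),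
          (n ≠ 4 → σ = CutMatching.mmwuStrategy (fun _ => 1)) ∧
          (∀ h, ∀ L ∈ (σ h).support, 2 * L.card = n) ∧
          ∀ (τ : CutMatching.MatchingStrategy (Fin n)), τ.IsLegal (fun _ => 1) →
            ENNReal.ofReal p ≤ CutMatching.winProb (fun _ => 1) σ τ
              (CutMatching.rounds C n) (c * Real.log n)) := by
  intro p hp
  -- Markov's inequality is applied with failure probability `n ^ (-m) ≤ exp (-m) ≤ 1 - p`.
  set m : ℝ := max 0 (-Real.log (1 - p))
  have hm : 0 ≤ m := le_max_left _ _
  have hpm : Real.exp (-m) ≤ 1 - p := by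
    rw [← Real.le_log_iff_exp_le (by linarith)]
    linarith [le_max_right 0 (-Real.log (1 - p))]
  refine ⟨4000 * (2 + m), by positivity, 8, by norm_num, fun n hn π hπ τ hτ =>
    CutMatching.ofReal_le_winProb_mmwuStrategy hn hπ hτ hm hpm, fun n hn heven => ?_⟩
  by_cases h4 : n = 4
  · subst h4
    refine ⟨CutMatching.bisectionStrategy, fun h => absurd rfl h, fun h L hL => ?_, fun τ hτ => ?_⟩
    · rw [CutMatching.bisectionStrategy, PMF.mem_support_pure_iff] at hL
      rw [hL, (CutMatching.card_bisection _).1]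
    · refine (ENNReal.ofReal_le_one.2 hp.le).trans
        (CutMatching.one_le_winProb_bisectionStrategy hτ ?_)
      have hlog : Real.log (4 : ℕ) = 2 * Real.log 2 := by
        rw [show ((4 : ℕ) : ℝ) = 2 ^ 2 by norm_num, Real.log_pow]
        norm_num
      have hlo := Real.log_two_gt_d9
      have hT : (36 : ℝ) ≤ CutMatching.rounds (4000 * (2 + m)) 4 := by
        refine le_trans ?_ (Nat.le_ceil _)
        rw [hlog]
        nlinarith [mul_nonneg hm (sq_nonneg (Real.log 2))]
      have hT' : 36 ≤ CutMatching.rounds (4000 * (2 + m)) 4 := by exact_mod_cast hT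
      have h12 : 12 ≤ CutMatching.rounds (4000 * (2 + m)) 4 / 3 := by omega
      have h12' : (12 : ℝ) ≤ (CutMatching.rounds (4000 * (2 + m)) 4 / 3 : ℕ) := by
        exact_mod_cast h12
      rw [hlog]
      linarith [Real.log_two_lt_d9]
  · have : Nontrivial (Fin n) := Fin.nontrivial_iff_two_le.2 hn
    refine ⟨CutMatching.mmwuStrategy fun _ => 1, fun _ => rfl, fun h L hL => ?_, fun τ hτ =>
      CutMatching.ofReal_le_winProb_mmwuStrategy hn (fun _ => one_pos) hτ hm hpm⟩
    have hw : CutMatching.weight (fun _ : Fin n => (1 : ℝ)) Finset.univ = n := by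
      simp [CutMatching.weight]
    by_cases h2 : n = 2
    · subst h2
      obtain ⟨v, hv⟩ := CutMatching.exists_mmwuStrategy_eq_of_heavy (π := fun _ : Fin 2 => (1 : ℝ))
        ⟨0, by rw [hw]; norm_num⟩
      rw [hv, PMF.mem_support_pure_iff] at hL
      rw [hL, Finset.card_singleton]
    · have h5 : (5 : ℝ) ≤ n := by
        obtain ⟨r, rfl⟩ := heven
        have : 5 ≤ r + r := by omega
        exact_mod_cast this
      obtain ⟨x, hx, rfl⟩ := CutMatching.exists_of_mem_support_mmwuStrategy
        (fun _ => one_pos) (fun _ => by rw [hw]; linarith) hL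
      exact CutMatching.two_mul_card_medianCut hn heven hx
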